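/- Let $n\ge 0$ and let $\Sigma\subset\mathbb{R}^{n+1}$ be a nonempty smooth embedded hypersurface without boundary. For a local smooth unit normal field $\nu$ of $\Sigma$ let $A(u,v)=\langle D_u\nu,v\rangle$ ($u,v\in T_p\Sigma$) be the second fundamental form, $|A|$ its norm with respect to the induced metric and $H=\operatorname{tr}A=\operatorname{div}_\Sigma\nu$ the mean curvature. Call $\Sigma$ a self-shrinker if $H=\langle x,\nu\rangle$ at every point $x\in\Sigma$; this condition and $|A|^2$ do not depend on the choice of sign of $\nu$. Say that $\Sigma$ has polynomial volume growth if there are constants $C$ and $d$ such that $\mathrm{Vol}_n(\Sigma\cap B_r(0))\le C r^d$ for all $r\ge 1$. (1) If $\Sigma$ is a self-shrinker that is complete (for the Riemannian distance of the induced metric), has polynomial volume growth and satisfies $|A|^2<1$ everywhere, then $\Sigma$ is a hyperplane. (2) The bound is optimal: for all integers $0\le k<n$ the cylinder $\mathbb{R}^k\times S^{n-k}(\sqrt{n-k})\subset\mathbb{R}^{n+1}$ is a smooth complete embedded self-shrinker without boundary and with polynomial volume growth, it satisfies $|A|^2= 1$ everywhere, and it is not a hyperplane. -/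

import Mathlib

open Set Filter Topology MeasureTheory
open scoped ContDiff NNReal ENNReal InnerProductSpace

noncomputable section

/-- Euclidean space `ℝ^{n+1}`. -/
abbrev Ambient (n : ℕ) : Type := EuclideanSpace ℝ (Fin (n + 1))

/-- `M ⊆ ℝ^{n+1}` is a smooth embedded hypersurface without boundary: near each of its points it is
the zero set of a smooth real function whose differential does not vanish. (It may be empty or
disconnected.) -/
def IsSmoothHypersurface {n : ℕ} (M : Set (Ambient n)) : Prop :=
  ∀ p ∈ M, ∃ (U : Set (Ambient n)) (f : Ambient n → ℝ), IsOpen U ∧ p ∈ U ∧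
    ContDiffOn ℝ ∞ f U ∧ (∀ q ∈ U, fderiv ℝ f q ≠ 0) ∧ M ∩ U = {q ∈ U | f q = 0}

/-- The tangent space `T_p M`: the span of the velocities at `p` of curves in `M` through `p`. -/
def tangentSubspace {n : ℕ} (M : Set (Ambient n)) (p : Ambient n) : Submodule ℝ (Ambient n) :=
  Submodule.span ℝ {v | ∃ γ : ℝ → Ambient n, γ 0 = p ∧ (∀ᶠ t in 𝓝 0, γ t ∈ M) ∧ HasDerivAt γ v 0}

/-- `ν` is a smooth unit normal field of `M` on the part of `M` that lies in the open set `U`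
(given through a smooth extension to `U`). -/
structure IsUnitNormalField {n : ℕ} (M U : Set (Ambient n)) (ν : Ambient n → Ambient n) :
    Prop where
  isOpen : IsOpen U
  contDiffOn : ContDiffOn ℝ ∞ ν U
  norm_eq_one : ∀ q ∈ M ∩ U, ‖ν q‖ = 1
  inner_eq_zero : ∀ q ∈ M ∩ U, ∀ v ∈ tangentSubspace M q, ⟪ν q, v⟫_ℝ = 0

/-- Unit normal fields exist near each point of a smooth hypersurface. -/
theorem IsSmoothHypersurface.exists_isUnitNormalField {n : ℕ} {M : Set (Ambient n)}
    (hM : IsSmoothHypersurface M) {p : Ambient n} (hp : p ∈ M) :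
    ∃ U ν, IsUnitNormalField M U ν ∧ p ∈ U := by
  obtain ⟨U, f, hU, hpU, hf, hne, hMU⟩ := hM p hp
  have hg : ContDiffOn ℝ ∞ (fun q => gradient f q) U :=
    (InnerProductSpace.toDual ℝ (Ambient n)).symm.contDiff.comp_contDiffOn
      (hf.fderiv_of_isOpen hU (by simp))
  have hg0 : ∀ q ∈ U, gradient f q ≠ 0 := fun q hq h =>
    hne q hq ((InnerProductSpace.toDual ℝ (Ambient n)).symm.map_eq_zero_iff.1 h)
  refine ⟨U, fun q => ‖gradient f q‖⁻¹ • gradient f q, ⟨hU, ?_, ?_, ?_⟩, hpU⟩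
  · exact ((hg.norm ℝ hg0).inv fun q hq => norm_ne_zero_iff.2 (hg0 q hq)).smul hg
  · intro q hq
    rw [norm_smul, norm_inv, norm_norm, inv_mul_cancel₀ (norm_ne_zero_iff.2 (hg0 q hq.2))]
  · intro q hq v hv
    rw [inner_smul_left]
    refine mul_eq_zero_of_right _ ?_
    induction hv using Submodule.span_induction with
    | mem v hv =>
      obtain ⟨γ, rfl, hγM, hγ⟩ := hv
      have hd : DifferentiableAt ℝ f (γ 0) :=
        (hf.contDiffAt (hU.mem_nhds hq.2)).differentiableAt (by simp)
      have h1 : HasDerivAt (f ∘ γ) (fderiv ℝ f (γ 0) v) 0 := hd.hasFDerivAt.comp_hasDerivAt 0 hγ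
      have h2 : f ∘ γ =ᶠ[𝓝 0] fun _ => (0 : ℝ) := by
        filter_upwards [hγM, hγ.continuousAt.eventually (hU.mem_nhds hq.2)] with t ht ht'
        exact (hMU.le ⟨ht, ht'⟩).2
      have h3 : fderiv ℝ f (γ 0) v = 0 :=
        h1.unique ((hasDerivAt_const (0 : ℝ) (0 : ℝ)).congr_of_eventuallyEq h2)
      rw [gradient, InnerProductSpace.toDual_symm_apply, h3]
    | zero => exact inner_zero_right _
    | add x y _ _ hx hy => rw [inner_add_right, hx, hy, add_zero]
    | smul a x _ hx => rw [inner_smul_right, hx, mul_zero]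

/-- The second fundamental form `A(u, v) = ⟨D_u ν, v⟩` at `p`, for tangent vectors `u`, `v`. -/
def secondFundamentalForm {n : ℕ} (M : Set (Ambient n)) (ν : Ambient n → Ambient n) (p : Ambient n)
    (u v : tangentSubspace M p) : ℝ :=
  ⟪fderiv ℝ ν p (u : Ambient n), (v : Ambient n)⟫_ℝ

/-- The mean curvature `H = tr A = div_M ν` at `p`, computed in an orthonormal basis of `T_p M`. -/
def meanCurvature {n : ℕ} (M : Set (Ambient n)) (ν : Ambient n → Ambient n) (p : Ambient n) : ℝ :=
  ∑ i, secondFundamentalForm M ν p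
    (stdOrthonormalBasis ℝ (tangentSubspace M p) i) (stdOrthonormalBasis ℝ (tangentSubspace M p) i)

/-- The squared norm `|A|²` at `p`, computed in an orthonormal basis of `T_p M`. -/
def normSqSecondFundamentalForm {n : ℕ} (M : Set (Ambient n)) (ν : Ambient n → Ambient n)
    (p : Ambient n) : ℝ :=
  ∑ i, ∑ j, secondFundamentalForm M ν p
    (stdOrthonormalBasis ℝ (tangentSubspace M p) i)
    (stdOrthonormalBasis ℝ (tangentSubspace M p) j) ^ 2

/-- The self-shrinker equation `H = ⟨x, ν⟩`. Both sides change sign with `ν`, so that the equation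
does not depend on the local choice of the unit normal. -/
def IsSelfShrinker {n : ℕ} (M : Set (Ambient n)) : Prop :=
  ∀ U ν, IsUnitNormalField M U ν → ∀ p ∈ M ∩ U, meanCurvature M ν p = ⟪p, ν p⟫_ℝ

/-- The intrinsic distance of `M`: the infimum of the lengths of the paths in `M` from `p` to `q`
(`∞` if there is no rectifiable one). On a smooth embedded hypersurface this is the Riemannian
distance of the induced metric. -/
def intrinsicEDist {n : ℕ} (M : Set (Ambient n)) (p q : Ambient n) : ℝ≥0∞ :=
  ⨅ (γ : ℝ → Ambient n) (_ : ContinuousOn γ (Icc 0 1)) (_ : MapsTo γ (Icc 0 1) M)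
    (_ : γ 0 = p) (_ : γ 1 = q), eVariationOn γ (Icc 0 1)

/-- `M` is complete for its intrinsic distance: each Cauchy sequence in `M` converges in `M`. -/
def IsIntrinsicallyComplete {n : ℕ} (M : Set (Ambient n)) : Prop :=
  ∀ u : ℕ → Ambient n, (∀ k, u k ∈ M) →
    (∀ ε : ℝ≥0∞, 0 < ε → ∃ N, ∀ k ≥ N, ∀ l ≥ N, intrinsicEDist M (u k) (u l) < ε) →
    ∃ p ∈ M, Tendsto (fun k => intrinsicEDist M (u k) p) atTop (𝓝 0)

/-- Polynomial volume growth: `Vol_n (M ∩ B_r(0)) ≤ C r^d` for all `r ≥ 1`, for some `C` and `d`,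
where `Vol_n` is the `n`-dimensional Hausdorff measure, normalized to agree with Lebesgue measure
on `n`-dimensional subspaces. -/
def HasPolynomialVolumeGrowth {n : ℕ} (M : Set (Ambient n)) : Prop :=
  ∃ (C : ℝ≥0) (d : ℕ), ∀ r : ℝ≥0, 1 ≤ r →
    Measure.euclideanHausdorffMeasure n (M ∩ Metric.ball 0 r) ≤ C * (r : ℝ≥0∞) ^ d

/-- `M` is an (affine) hyperplane. -/
def IsHyperplane {n : ℕ} (M : Set (Ambient n)) : Prop :=
  ∃ (w : Ambient n) (c : ℝ), w ≠ 0 ∧ M = {x | ⟪w, x⟫_ℝ = c}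

/-- The cylinder `ℝ^k × S^{n-k}(√(n-k))` in `ℝ^{n+1} = ℝ^k × ℝ^{n-k+1}`. -/
def shrinkingCylinder (n k : ℕ) : Set (Ambient n) :=
  {x | √(∑ i : Fin (n + 1) with k ≤ i.val, x i ^ 2) = √((n : ℝ) - k)}

end

/-! Write H = ⟨x, ν⟩ and let L = Δ − ⟨x, ∇·⟩ be the drift Laplacian of M. The Codazzi equation and
the shrinker equation give LH = (1 − |A|²)H, while L|x|² = 2(n − |x|²). When |A|² < 1, the function
H² is therefore L-subharmonic, strictly so where H ≠ 0. If H² attains a maximum, the maximum is 0.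
Since H² ≤ n|A|² ≤ n, a maximum can be forced by subtracting ε|x|²: on a closed M the function H² −
ε|x|² attains its maximum at some q, where H²(1 − |A|²) ≤ ε(n − |q|²), so |q|² ≤ n. As ε tends to 0
this places a maximum of H² itself in the compact set |x|² ≤ n, and H vanishes identically
(`maximum_principle`, `IsSelfShrinker.normalSq_self_eq_zero`).

If H = 0, the position vector is tangent everywhere, so M is invariant under positive dilations.
Being closed, it contains 0; being smooth there, it equals its tangent hyperplane at 0
(`IsSmoothHypersurface.isHyperplane_of_normalSq_self_eq_zero`).

What remains is that completeness, |A| < 1 and volume growth make M closed. The bound on A limits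
how fast the normal turns, so M contains near each point a graph over a ball of fixed radius in the
tangent plane (`IsSmoothHypersurface.exists_lift`). Small intrinsic balls thus have volume bounded
below. Volume growth leaves room for only finitely many disjoint ones in a bounded region, so
bounded parts of M are totally bounded for the intrinsic distance, hence compact
(`IsSmoothHypersurface.totallyBounded`, `IsSmoothHypersurface.isClosed_of_isIntrinsicallyComplete`).

No global unit normal is chosen: ⟨v, ν⟩² is replaced by the sign-free `normalSq`. Local computations
use graphs extended to be constant along one direction, so that traces over the tangent space become
traces over the ambient space.

For the cylinders, let P be the orthogonal projection to the last n + 1 − k coordinates. The normal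
is Px/√(n−k), A is the restriction of P/√(n−k), and the trace of P on the tangent space is n − k. -/

/-! ### Directional derivatives and the maximum principle for H² − ε|x|² -/

section Calculus

variable {E : Type*} [NormedAddCommGroup E] [InnerProductSpace ℝ E]
variable {F : Type*} [NormedAddCommGroup F] [InnerProductSpace ℝ F]

/-- The derivative of `φ` in the constant direction `b`. -/
noncomputable def dirDeriv (b : E) (φ : E → F) (x : E) : F := fderiv ℝ φ x b

theorem ContDiffOn.dirDeriv {D : Set E} (hD : IsOpen D) {φ : E → F} (hφ : ContDiffOn ℝ ∞ φ D)
    (b : E) : ContDiffOn ℝ ∞ (dirDeriv b φ) D :=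
  (hφ.fderiv_of_isOpen hD (by simp)).clm_apply contDiffOn_const

theorem ContDiffOn.differentiableAt_of_isOpen {D : Set E} (hD : IsOpen D) {φ : E → F}
    (hφ : ContDiffOn ℝ ∞ φ D) {x : E} (hx : x ∈ D) : DifferentiableAt ℝ φ x :=
  (hφ.contDiffAt (hD.mem_nhds hx)).differentiableAt (by simp)

theorem dirDeriv_congr {D : Set E} (hD : IsOpen D) {φ ψ : E → F} (h : EqOn φ ψ D) (b : E) :
    EqOn (dirDeriv b φ) (dirDeriv b ψ) D := fun x hx => by
  have : φ =ᶠ[𝓝 x] ψ := h.eventuallyEq_of_mem (hD.mem_nhds hx)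
  simp [dirDeriv, this.fderiv_eq]

theorem dirDeriv_inner {D : Set E} (hD : IsOpen D) {φ ψ : E → F} (hφ : ContDiffOn ℝ ∞ φ D)
    (hψ : ContDiffOn ℝ ∞ ψ D) (b : E) {x : E} (hx : x ∈ D) :
    dirDeriv b (fun y => ⟪φ y, ψ y⟫_ℝ) x = ⟪φ x, dirDeriv b ψ x⟫_ℝ + ⟪dirDeriv b φ x, ψ x⟫_ℝ :=
  fderiv_inner_apply ℝ (hφ.differentiableAt_of_isOpen hD hx) (hψ.differentiableAt_of_isOpen hD hx) b

theorem dirDeriv_mul_sub_mul {D : Set E} (hD : IsOpen D) {φ ψ : E → ℝ} (hφ : ContDiffOn ℝ ∞ φ D)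
    (hψ : ContDiffOn ℝ ∞ ψ D) (s t : ℝ) (b : E) {x : E} (hx : x ∈ D) :
    dirDeriv b (fun y => s * φ y - t * ψ y) x = s * dirDeriv b φ x - t * dirDeriv b ψ x := by
  have h1 := hφ.differentiableAt_of_isOpen hD hx
  have h2 := hψ.differentiableAt_of_isOpen hD hx
  simp [dirDeriv, fderiv_fun_sub (h1.const_mul s) (h2.const_mul t), fderiv_const_mul h1,
    fderiv_const_mul h2]

theorem dirDeriv_mul {D : Set E} (hD : IsOpen D) {φ ψ : E → ℝ} (hφ : ContDiffOn ℝ ∞ φ D)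
    (hψ : ContDiffOn ℝ ∞ ψ D) (b : E) {x : E} (hx : x ∈ D) :
    dirDeriv b (fun y => φ y * ψ y) x = φ x * dirDeriv b ψ x + dirDeriv b φ x * ψ x := by
  have h1 := hφ.differentiableAt_of_isOpen hD hx
  have h2 := hψ.differentiableAt_of_isOpen hD hx
  simp [dirDeriv, fderiv_fun_mul h1 h2, mul_comm]

theorem dirDeriv_eq_zero_of_const {D : Set E} (hD : IsOpen D) {φ : E → F} {k : F}
    (h : ∀ x ∈ D, φ x = k) (b : E) {x : E} (hx : x ∈ D) : dirDeriv b φ x = 0 := by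
  rw [dirDeriv_congr hD (ψ := fun _ => k) h b hx]
  simp [dirDeriv]

theorem dirDeriv_comm {D : Set E} (hD : IsOpen D) {φ : E → F} (hφ : ContDiffOn ℝ ∞ φ D) (a b : E)
    {x : E} (hx : x ∈ D) : dirDeriv a (dirDeriv b φ) x = dirDeriv b (dirDeriv a φ) x := by
  have hd : DifferentiableAt ℝ (fderiv ℝ φ) x :=
    ((hφ.fderiv_of_isOpen hD (m := ∞) (by simp)).contDiffAt (hD.mem_nhds hx)).differentiableAt
      (by simp)
  have h (a b : E) : dirDeriv a (dirDeriv b φ) x = fderiv ℝ (fderiv ℝ φ) x a b := by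
    unfold dirDeriv
    rw [fderiv_clm_apply hd (by fun_prop)]
    simp
  rw [h, h]
  exact ((hφ.contDiffAt (hD.mem_nhds hx)).isSymmSndFDerivAt (by
    rw [minSmoothness_of_isRCLikeNormedField]; exact WithTop.coe_le_coe.2 le_top)).eq a b

/-- The second order condition at a local maximum. -/
theorem IsLocalMax.dirDeriv_dirDeriv_nonpos {D : Set E} (hD : IsOpen D) {φ : E → ℝ}
    (hφ : ContDiffOn ℝ ∞ φ D) {x : E} (hx : x ∈ D) (hmax : IsLocalMax φ x) (b : E) :
    dirDeriv b (dirDeriv b φ) x ≤ 0 := by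
  by_contra! hpos
  set c : ℝ → E := fun t => x + t • b with hc
  have hc0 : c 0 = x := by simp [hc]
  have hcd (t : ℝ) : HasDerivAt c b t := by
    simpa [hc] using ((hasDerivAt_id t).smul_const b).const_add x
  have hcD : ∀ᶠ t in 𝓝 0, c t ∈ D :=
    (hcd 0).continuousAt.eventually (by rw [hc0]; exact hD.mem_nhds hx)
  have hder {ψ : E → ℝ} (hψ : ContDiffOn ℝ ∞ ψ D) {t : ℝ} (ht : c t ∈ D) :
      HasDerivAt (ψ ∘ c) (_root_.dirDeriv b ψ (c t)) t :=
    (hψ.differentiableAt_of_isOpen hD ht).hasFDerivAt.comp_hasDerivAt t (hcd t)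
  have h1 : deriv (φ ∘ c) =ᶠ[𝓝 0] _root_.dirDeriv b φ ∘ c := by
    filter_upwards [hcD] with t ht using (hder hφ ht).deriv
  have h2 : deriv (deriv (φ ∘ c)) 0 = _root_.dirDeriv b (_root_.dirDeriv b φ) x := by
    rw [h1.deriv_eq, (hder (hφ.dirDeriv hD b) (by rwa [hc0])).deriv, hc0]
  have hmax' : IsLocalMax (φ ∘ c) 0 := by
    have := (hcd 0).continuousAt.eventually (by rw [hc0]; exact hmax)
    simpa [IsLocalMax, IsMaxFilter, hc0] using this
  -- A positive second derivative makes the maximum a minimum as well, so the function is locally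
  -- constant and its second derivative vanishes.
  have hmin : IsLocalMin (φ ∘ c) 0 := isLocalMin_of_deriv_deriv_pos (by rw [h2]; exact hpos)
    hmax'.deriv_eq_zero (hder hφ (by rwa [hc0])).continuousAt
  have hconst : φ ∘ c =ᶠ[𝓝 0] fun _ => (φ ∘ c) 0 := by
    filter_upwards [hmax', hmin] with t h h' using le_antisymm h h'
  have h3 : deriv (deriv (φ ∘ c)) 0 = 0 := by
    rw [hconst.deriv.deriv_eq]; simp
  linarith

/-- At a local maximum of `⟨r, ν⟩² - ε |r|²`, for a graph `r` over its tangent plane at `p` with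
unit normal `ν` that solves the self-shrinker equation. -/
theorem maximum_principle {ι : Type*} [Fintype ι] (b : OrthonormalBasis ι ℝ E) {D : Set E}
    (hD : IsOpen D) {p e : E} (hp : p ∈ D) (he : ‖e‖ = 1) {ν r : E → E} {a : E → ℝ}
    (hν : ContDiffOn ℝ ∞ ν D) (ha : ContDiffOn ℝ ∞ a D) (hr : ∀ x, r x = x + a x • e)
    (hrp : r p = p) (hνp : ν p = e) (hν1 : ∀ x ∈ D, ‖ν x‖ = 1)
    (htan : ∀ x ∈ D, ∀ c, ⟪ν x, dirDeriv c r x⟫_ℝ = 0)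
    (hνe : ∀ x ∈ D, dirDeriv e ν x = 0)
    (hH : ∀ x ∈ D, ⟪r x, ν x⟫_ℝ = ∑ i, ⟪dirDeriv (b i) ν x, b i⟫_ℝ) {ε : ℝ}
    (hmax : IsLocalMax (fun x => ⟪r x, ν x⟫_ℝ ^ 2 - ε * ⟪r x, r x⟫_ℝ) p) :
    ⟪p, e⟫_ℝ ^ 2 * (1 - ∑ i, ‖dirDeriv (b i) ν p‖ ^ 2) ≤ ε * (Fintype.card ι - 1 - ‖p‖ ^ 2) := by
  have heD : ⟪e, e⟫_ℝ = 1 := by rw [real_inner_self_eq_norm_sq, he, one_pow]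
  have hrs : ContDiffOn ℝ ∞ r D := by
    rw [show r = fun x => x + a x • e from funext hr]
    exact contDiffOn_id.add (ha.smul contDiffOn_const)
  set h : E → ℝ := fun x => ⟪r x, ν x⟫_ℝ with hh
  have hhs : ContDiffOn ℝ ∞ h D := hrs.inner ℝ hν
  have hdr (c : E) : ∀ x ∈ D, dirDeriv c r x = c + dirDeriv c a x • e := fun x hx => by
    have h1 := ha.differentiableAt_of_isOpen hD hx
    have h2 := (hasFDerivAt_id x).add (h1.hasFDerivAt.smul_const e)
    have h3 : HasFDerivAt r _ x := h2.congr_of_eventuallyEq (.of_forall hr)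
    simp [dirDeriv, h3.fderiv]
  have hddr (c d : E) : dirDeriv c (dirDeriv d r) p = dirDeriv c (dirDeriv d a) p • e := by
    have h1 := (ha.dirDeriv hD d).differentiableAt_of_isOpen hD hp
    rw [dirDeriv_congr hD (hdr d) c hp]
    unfold dirDeriv at h1 ⊢
    rw [fderiv_const_add, fderiv_smul_const h1]
    rfl
  -- At `p` the graph is tangent to the orthogonal complement of `e`, so the derivative of `r` is
  -- the orthogonal projection. It kills `e`, and sums over the basis `b` of the whole space act as
  -- traces over the tangent plane. The induced metric is flat to first order at `p`, so there the
  -- sum of the second derivatives is Δ.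
  have hdrp (c : E) : dirDeriv c r p = c - ⟪e, c⟫_ℝ • e := by
    have := htan p hp c
    rw [hdr c p hp, hνp, inner_add_right, inner_smul_right, heD] at this
    rw [hdr c p hp, show dirDeriv c a p = -⟪e, c⟫_ℝ by linarith, neg_smul, sub_eq_add_neg]
  have hdh (c : E) : ∀ x ∈ D, dirDeriv c h x = ⟪r x, dirDeriv c ν x⟫_ℝ := fun x hx => by
    rw [hh, dirDeriv_inner hD hrs hν c hx, real_inner_comm (ν x), htan x hx, add_zero]
  have hddh (c d : E) : dirDeriv c (dirDeriv d h) p =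
      ⟪p, dirDeriv c (dirDeriv d ν) p⟫_ℝ + ⟪dirDeriv c r p, dirDeriv d ν p⟫_ℝ := by
    rw [dirDeriv_congr hD (hdh d) c hp, dirDeriv_inner hD hrs (hν.dirDeriv hD d) c hp, hrp]
  have hνd (c : E) : ∀ x ∈ D, ⟪ν x, dirDeriv c ν x⟫_ℝ = 0 := fun x hx => by
    have h1 := dirDeriv_inner hD hν hν c hx
    rw [dirDeriv_eq_zero_of_const hD (k := 1) (fun y hy => by
      rw [real_inner_self_eq_norm_sq, hν1 y hy, one_pow]) c hx, real_inner_comm (ν x)] at h1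
    linarith
  have hed (c : E) : ⟪e, dirDeriv c ν p⟫_ℝ = 0 := by rw [← hνp]; exact hνd c p hp
  have hedd (c d : E) : ⟪e, dirDeriv c (dirDeriv d ν) p⟫_ℝ = -⟪dirDeriv c ν p, dirDeriv d ν p⟫_ℝ := by
    have h1 := dirDeriv_inner hD hν (hν.dirDeriv hD d) c hp
    rw [dirDeriv_eq_zero_of_const hD (hνd d) c hp, hνp] at h1
    linarith
  have hA (c d : E) : ∀ x ∈ D, ⟪dirDeriv c ν x, dirDeriv d r x⟫_ℝ =
      -⟪ν x, dirDeriv c (dirDeriv d r) x⟫_ℝ := fun x hx => by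
    have h1 := dirDeriv_inner hD hν (hrs.dirDeriv hD d) c hx
    rw [dirDeriv_eq_zero_of_const hD (fun y hy => htan y hy d) c hx] at h1
    linarith
  have hsymm (c d : E) : ∀ x ∈ D, ⟪dirDeriv c ν x, dirDeriv d r x⟫_ℝ =
      ⟪dirDeriv d ν x, dirDeriv c r x⟫_ℝ := fun x hx => by
    rw [hA c d x hx, hA d c x hx, dirDeriv_comm hD hrs c d hx]
  -- The Codazzi equation: differentiate the symmetry of A. The second derivatives of `r` at `p` are
  -- multiples of `e`, to which the derivatives of `ν` are orthogonal, so those terms drop out.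
  have hcod (c d f : E) : ⟪dirDeriv f (dirDeriv c ν) p, d - ⟪e, d⟫_ℝ • e⟫_ℝ =
      ⟪dirDeriv f (dirDeriv d ν) p, c - ⟪e, c⟫_ℝ • e⟫_ℝ := by
    have h1 := dirDeriv_congr hD (hsymm c d) f hp
    rw [dirDeriv_inner hD (hν.dirDeriv hD c) (hrs.dirDeriv hD d) f hp,
      dirDeriv_inner hD (hν.dirDeriv hD d) (hrs.dirDeriv hD c) f hp, hddr, hddr, inner_smul_right,
      inner_smul_right, real_inner_comm e, real_inner_comm e, hed, hed, hdrp, hdrp] at h1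
    linarith
  have hlin : ∑ i, ⟪e, b i⟫_ℝ • dirDeriv (b i) ν p = 0 := by
    rw [← hνe p hp]
    unfold dirDeriv
    conv_rhs => rw [← b.sum_repr' e, map_sum]
    simp [real_inner_comm]
  have hdivp : dirDeriv p h p = ∑ i, ⟪dirDeriv p (dirDeriv (b i) ν) p, b i⟫_ℝ := by
    rw [dirDeriv_congr hD hH p hp]
    have h1 (i : ι) : DifferentiableAt ℝ (fun x => ⟪dirDeriv (b i) ν x, b i⟫_ℝ) p :=
      (((hν.dirDeriv hD (b i)).inner ℝ contDiffOn_const)).differentiableAt_of_isOpen hD hp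
    rw [dirDeriv, fderiv_fun_sum fun i _ => h1 i, sum_apply]
    refine Finset.sum_congr rfl fun i _ => ?_
    have := dirDeriv_inner hD (hν.dirDeriv hD (b i)) (contDiffOn_const (c := b i)) p hp
    rw [dirDeriv_eq_zero_of_const hD (k := b i) (fun _ _ => rfl) p hp] at this
    simpa [dirDeriv] using this
  -- Split `p` into tangential and normal parts. By Codazzi the tangential part differentiates the
  -- trace of A, which is `h`; by `hedd` the normal part gives −⟨p, e⟩|A|². The correction from the
  -- component of `b i` along `e` sums to zero by `hlin`.
  have hlap : ∑ i, ⟪p, dirDeriv (b i) (dirDeriv (b i) ν) p⟫_ℝ =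
      dirDeriv p h p - ⟪p, e⟫_ℝ * ∑ i, ‖dirDeriv (b i) ν p‖ ^ 2 := by
    have h1 (i : ι) : ⟪p, dirDeriv (b i) (dirDeriv (b i) ν) p⟫_ℝ =
        ⟪dirDeriv p (dirDeriv (b i) ν) p, b i⟫_ℝ
          + ⟪dirDeriv p ν p, ⟪e, b i⟫_ℝ • dirDeriv (b i) ν p⟫_ℝ
          - ⟪p, e⟫_ℝ * ‖dirDeriv (b i) ν p‖ ^ 2 := by
      have h2 := hcod (b i) p (b i)
      rw [dirDeriv_comm hD hν (b i) p hp, inner_sub_right, inner_sub_right, inner_smul_right,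
        inner_smul_right, real_inner_comm e, real_inner_comm e, hedd, hedd,
        real_inner_self_eq_norm_sq] at h2
      rw [real_inner_comm, inner_smul_right, real_inner_comm e]
      linarith
    rw [hdivp, Finset.sum_congr rfl fun i _ => h1 i, Finset.sum_sub_distrib,
      Finset.sum_add_distrib, ← inner_sum, hlin, inner_zero_right, add_zero, Finset.mul_sum]
  have hhp : h p = ⟪p, e⟫_ℝ := by rw [hh]; simp only [hrp, hνp]
  have htr : ∑ i, ⟪dirDeriv (b i) r p, dirDeriv (b i) ν p⟫_ℝ = h p := by
    refine Eq.trans ?_ (hH p hp).symm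
    refine Finset.sum_congr rfl fun i _ => ?_
    rw [hdrp, inner_sub_left, inner_smul_left, hed, mul_zero, sub_zero, real_inner_comm]
  -- This is LH = (1 − |A|²)H at `p`, with the drift term `dirDeriv p h p` on the right.
  have hLh : ∑ i, dirDeriv (b i) (dirDeriv (b i) h) p =
      dirDeriv p h p - h p * ∑ i, ‖dirDeriv (b i) ν p‖ ^ 2 + h p := by
    rw [Finset.sum_congr rfl fun i _ => hddh (b i) (b i), Finset.sum_add_distrib, hlap, htr, hhp]
  set u : E → ℝ := fun x => 1 * (h x * h x) - ε * ⟪r x, r x⟫_ℝ with hu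
  have hus : ContDiffOn ℝ ∞ u D :=
    (contDiffOn_const.mul (hhs.mul hhs)).sub (contDiffOn_const.mul (hrs.inner ℝ hrs))
  have hmax' : IsLocalMax u p := by
    convert hmax using 2
    ring
  have hdu (c : E) : ∀ x ∈ D, dirDeriv c u x =
      2 * (h x * dirDeriv c h x) - (2 * ε) * ⟪r x, dirDeriv c r x⟫_ℝ := fun x hx => by
    rw [hu, dirDeriv_mul_sub_mul hD (hhs.mul hhs) (hrs.inner ℝ hrs) _ _ c hx,
      dirDeriv_mul hD hhs hhs c hx, dirDeriv_inner hD hrs hrs c hx, real_inner_comm (r x)]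
    ring
  have hddu (c : E) : dirDeriv c (dirDeriv c u) p =
      2 * (h p * dirDeriv c (dirDeriv c h) p + dirDeriv c h p * dirDeriv c h p) -
      (2 * ε) * (⟪p, dirDeriv c (dirDeriv c r) p⟫_ℝ + ⟪dirDeriv c r p, dirDeriv c r p⟫_ℝ) := by
    rw [dirDeriv_congr hD (hdu c) c hp, dirDeriv_mul_sub_mul hD (hhs.mul (hhs.dirDeriv hD c))
      (hrs.inner ℝ (hrs.dirDeriv hD c)) _ _ c hp, dirDeriv_mul hD hhs (hhs.dirDeriv hD c) c hp,
      dirDeriv_inner hD hrs (hrs.dirDeriv hD c) c hp, hrp]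
  -- The first order condition in the direction `p` removes the drift term.
  have hcrit : h p * dirDeriv p h p = ε * (‖p‖ ^ 2 - h p ^ 2) := by
    have h1 := hdu p p hp
    rw [show dirDeriv p u p = 0 by rw [dirDeriv, hmax'.fderiv_eq_zero]; rfl, hrp, hdrp,
      inner_sub_right, inner_smul_right, real_inner_self_eq_norm_sq, real_inner_comm, ← hhp] at h1
    linarith
  -- The identity Δx = −Hν, paired with the position vector.
  have hα : ∑ i, ⟪p, dirDeriv (b i) (dirDeriv (b i) r) p⟫_ℝ = -(h p * h p) := by
    have h1 (i : ι) : ⟪p, dirDeriv (b i) (dirDeriv (b i) r) p⟫_ℝ =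
        -(h p * ⟪dirDeriv (b i) r p, dirDeriv (b i) ν p⟫_ℝ) := by
      rw [real_inner_comm (dirDeriv (b i) ν p), hA _ _ p hp, hddr, inner_smul_right,
        inner_smul_right, hνp, heD, hhp]
      ring
    rw [Finset.sum_congr rfl fun i _ => h1 i, Finset.sum_neg_distrib, ← Finset.mul_sum, htr]
  have hcard : ∑ i, ⟪dirDeriv (b i) r p, dirDeriv (b i) r p⟫_ℝ = Fintype.card ι - 1 := by
    have h1 (i : ι) : ⟪dirDeriv (b i) r p, dirDeriv (b i) r p⟫_ℝ = 1 - ⟪e, b i⟫_ℝ ^ 2 := by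
      rw [hdrp, inner_sub_left, inner_sub_right, inner_sub_right, inner_smul_right,
        inner_smul_left, inner_smul_left, inner_smul_right, heD, real_inner_self_eq_norm_sq,
        b.norm_eq_one, real_inner_comm e]
      simp
      ring
    have h2 : ∑ i, ⟪e, b i⟫_ℝ ^ 2 = 1 := by
      have := b.sum_sq_norm_inner_left e
      simpa [he] using this
    rw [Finset.sum_congr rfl fun i _ => h1 i, Finset.sum_sub_distrib, h2]
    simp
  have hfin : ∑ i, dirDeriv (b i) (dirDeriv (b i) u) p ≤ 0 :=
    Finset.sum_nonpos fun i _ => hmax'.dirDeriv_dirDeriv_nonpos hD hus hp (b i)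
  rw [Finset.sum_congr rfl fun i _ => hddu (b i), Finset.sum_sub_distrib, ← Finset.mul_sum,
    Finset.sum_add_distrib, ← Finset.mul_sum, ← Finset.mul_sum, Finset.sum_add_distrib, hLh, hα,
    hcard] at hfin
  -- The term |∇H|² has the favourable sign and is discarded.
  have hsq : 0 ≤ ∑ i, dirDeriv (b i) h p * dirDeriv (b i) h p :=
    Finset.sum_nonneg fun i _ => mul_self_nonneg _
  rw [← hhp]
  linarith [mul_add (h p) (dirDeriv p h p - h p * ∑ i, ‖dirDeriv (b i) ν p‖ ^ 2) (h p)]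

end Calculus

/-! ### Traces split along a hyperplane and its unit normal -/

section Trace

variable {E : Type*} [NormedAddCommGroup E] [InnerProductSpace ℝ E]

/-- An orthonormal basis of the hyperplane together with `e` is one of the whole space. The trace
identities below follow by pairing this expansion with vectors. -/
theorem OrthonormalBasis.sum_inner_smul_add_of_orthogonal {ι : Type*} [Fintype ι]
    {T : Submodule ℝ E} (t : OrthonormalBasis ι ℝ T) {e : E} (he : ‖e‖ = 1)
    (hT : ∀ v, v ∈ T ↔ ⟪e, v⟫_ℝ = 0) (x : E) :
    ∑ i, ⟪(t i : E), x⟫_ℝ • (t i : E) + ⟪e, x⟫_ℝ • e = x := by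
  have hx : x - ⟪e, x⟫_ℝ • e ∈ T := by
    rw [hT, inner_sub_right, inner_smul_right, real_inner_self_eq_norm_sq, he]
    simp
  have h1 := congrArg (Subtype.val) (t.sum_repr' ⟨_, hx⟩)
  have h2 (i : ι) : ⟪(t i : E), e⟫_ℝ = 0 := by
    rw [real_inner_comm]; exact (hT _).1 (t i).2
  simp only [Submodule.coe_sum, Submodule.coe_smul, Submodule.coe_inner, inner_sub_right,
    inner_smul_right, h2, mul_zero, sub_zero] at h1
  rw [h1, sub_add_cancel]

/-- The trace of an operator, split along a hyperplane and its unit normal. -/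
theorem OrthonormalBasis.sum_inner_add_inner_eq {ι κ : Type*} [Fintype ι] [Fintype κ]
    {T : Submodule ℝ E} (t : OrthonormalBasis ι ℝ T) (b : OrthonormalBasis κ ℝ E) {e : E}
    (he : ‖e‖ = 1) (hT : ∀ v, v ∈ T ↔ ⟪e, v⟫_ℝ = 0) (B : E →L[ℝ] E) :
    ∑ i, ⟪B (t i), (t i : E)⟫_ℝ + ⟪B e, e⟫_ℝ = ∑ j, ⟪B (b j), b j⟫_ℝ := by
  have h1 (v : E) : ∑ j, ⟪v, b j⟫_ℝ * ⟪B (b j), v⟫_ℝ = ⟪B v, v⟫_ℝ := by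
    conv_rhs => rw [← b.sum_repr' v, map_sum, b.sum_repr' v, sum_inner]
    simp [inner_smul_left, real_inner_comm]
  have h2 (j : κ) : ⟪B (b j), b j⟫_ℝ =
      ∑ i, ⟪(t i : E), b j⟫_ℝ * ⟪B (b j), t i⟫_ℝ + ⟪e, b j⟫_ℝ * ⟪B (b j), e⟫_ℝ := by
    have h3 := congrArg (fun y => ⟪B (b j), y⟫_ℝ) (t.sum_inner_smul_add_of_orthogonal he hT (b j))
    simp only [inner_add_right, inner_sum, inner_smul_right] at h3
    exact h3.symm
  rw [Finset.sum_congr rfl fun j _ => h2 j, Finset.sum_add_distrib, Finset.sum_comm, h1,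
    Finset.sum_congr rfl fun i _ => h1 (t i)]

/-- The squared Hilbert-Schmidt norm of an operator, split along a hyperplane and its normal. -/
theorem OrthonormalBasis.sum_norm_sq_add_norm_sq_eq {ι κ : Type*} [Fintype ι] [Fintype κ]
    [CompleteSpace E] {T : Submodule ℝ E} (t : OrthonormalBasis ι ℝ T)
    (b : OrthonormalBasis κ ℝ E) {e : E} (he : ‖e‖ = 1) (hT : ∀ v, v ∈ T ↔ ⟪e, v⟫_ℝ = 0)
    (B : E →L[ℝ] E) :
    ∑ i, ‖B (t i)‖ ^ 2 + ‖B e‖ ^ 2 = ∑ j, ‖B (b j)‖ ^ 2 := by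
  have h := t.sum_inner_add_inner_eq b he hT (B.adjoint.comp B)
  simpa [ContinuousLinearMap.adjoint_inner_left] using h

theorem OrthonormalBasis.sum_inner_sq_eq_norm_sq {ι : Type*} [Fintype ι]
    {T : Submodule ℝ E} (t : OrthonormalBasis ι ℝ T) {e : E} (he : ‖e‖ = 1)
    (hT : ∀ v, v ∈ T ↔ ⟪e, v⟫_ℝ = 0) (x : E) :
    ∑ i, ⟪x, (t i : E)⟫_ℝ ^ 2 + ⟪x, e⟫_ℝ ^ 2 = ‖x‖ ^ 2 := by
  rw [← real_inner_self_eq_norm_sq]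
  have h := congrArg (fun y => ⟪x, y⟫_ℝ) (t.sum_inner_smul_add_of_orthogonal he hT x)
  simp only [inner_add_right, inner_sum, inner_smul_right] at h
  rw [← h]
  simp [sq, real_inner_comm]

end Trace

/-! ### Local graphs from the implicit function theorem -/

section Graph

variable {n : ℕ}

/-- The component of `x` orthogonal to the unit vector `e`. -/
noncomputable def orthPart (e : Ambient n) : Ambient n →L[ℝ] Ambient n :=
  ContinuousLinearMap.id ℝ _ - (innerSL ℝ e).smulRight e

theorem orthPart_apply (e x : Ambient n) : orthPart e x = x - ⟪e, x⟫_ℝ • e := rfl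

theorem inner_orthPart {e : Ambient n} (he : ‖e‖ = 1) (x : Ambient n) :
    ⟪e, orthPart e x⟫_ℝ = 0 := by
  rw [orthPart_apply, inner_sub_right, inner_smul_right, real_inner_self_eq_norm_sq, he]
  simp

theorem orthPart_self {e : Ambient n} (he : ‖e‖ = 1) : orthPart e e = 0 := by
  rw [orthPart_apply, real_inner_self_eq_norm_sq, he]
  simp

theorem orthPart_of_inner_eq_zero {e x : Ambient n} (h : ⟪e, x⟫_ℝ = 0) : orthPart e x = x := by
  rw [orthPart_apply, h, zero_smul, sub_zero]

theorem orthPart_add_smul (e x : Ambient n) : orthPart e x + ⟪e, x⟫_ℝ • e = x := by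
  rw [orthPart_apply, sub_add_cancel]

theorem norm_sq_eq_orthPart {e : Ambient n} (he : ‖e‖ = 1) (x : Ambient n) :
    ‖x‖ ^ 2 = ‖orthPart e x‖ ^ 2 + ⟪e, x⟫_ℝ ^ 2 := by
  conv_lhs => rw [← orthPart_add_smul e x]
  rw [norm_add_sq_real, inner_smul_right, real_inner_comm e (orthPart e x), inner_orthPart he,
    norm_smul, he]
  simp

theorem norm_orthPart_le {e : Ambient n} (he : ‖e‖ = 1) (x : Ambient n) :
    ‖orthPart e x‖ ≤ ‖x‖ :=
  abs_le_of_sq_le_sq' (by nlinarith [norm_sq_eq_orthPart he x]) (norm_nonneg x) |>.2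

/-- The open solid cylinder of radius `δ` around the line through `p` in the direction `e`. -/
def solidCylinder (p e : Ambient n) (δ : ℝ) : Set (Ambient n) := {x | ‖orthPart e (x - p)‖ < δ}

theorem isOpen_solidCylinder (p e : Ambient n) (δ : ℝ) : IsOpen (solidCylinder p e δ) :=
  isOpen_lt (by fun_prop) continuous_const

/-- Near `p`, the set `M` is the graph of `g` in the direction of the unit vector `e`; `g` is
extended to be constant in this direction. -/
structure IsLocalGraph (M : Set (Ambient n)) (p e : Ambient n) (g : Ambient n → ℝ) (δ η : ℝ) :
    Prop where
  norm_eq_one : ‖e‖ = 1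
  pos : 0 < δ
  pos' : 0 < η
  contDiffOn : ContDiffOn ℝ ∞ g (solidCylinder p e δ)
  add_smul : ∀ x (s : ℝ), g (x + s • e) = g x
  apply_center : g p = ⟪e, p⟫_ℝ
  abs_sub_lt : ∀ x ∈ solidCylinder p e δ, |g x - ⟪e, p⟫_ℝ| < η
  mem_iff : ∀ x ∈ solidCylinder p e δ, |⟪e, x - p⟫_ℝ| < η → (x ∈ M ↔ ⟪e, x⟫_ℝ = g x)

/-- The implicit function theorem. The map Φ keeps the part of x orthogonal to `e` and records `f x`
as the component along `e`; it is a local diffeomorphism that flattens M. The height `g` is the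
component along `e` of the inverse of Φ, evaluated on the orthogonal part, so it is constant along
`e`. -/
theorem exists_isLocalGraph_of_fderiv_ne_zero {M U : Set (Ambient n)} {f : Ambient n → ℝ}
    (hU : IsOpen U) (hf : ContDiffOn ℝ ∞ f U) (hMU : M ∩ U = {q ∈ U | f q = 0}) {p e : Ambient n}
    (hpM : p ∈ M) (hpU : p ∈ U) (he : ‖e‖ = 1) (hfe : fderiv ℝ f p e ≠ 0) :
    ∃ g δ η, IsLocalGraph M p e g δ η := by
  have hee : ⟪e, e⟫_ℝ = 1 := by rw [real_inner_self_eq_norm_sq, he, one_pow]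
  set Φ : Ambient n → Ambient n := fun x => orthPart e x + f x • e with hΦ
  let L (q : Ambient n) : Ambient n →L[ℝ] Ambient n :=
    orthPart e + (fderiv ℝ f q).smulRight e
  have hΦs : ContDiffOn ℝ ∞ Φ U :=
    (orthPart e).contDiff.contDiffOn.add (hf.smul contDiffOn_const)
  have hΦd {q} (hq : q ∈ U) : HasFDerivAt Φ (L q) q :=
    (orthPart e).hasFDerivAt.add
      ((hf.differentiableAt_of_isOpen hU hq).hasFDerivAt.smul_const e)
  have hLinj {q} (hq : fderiv ℝ f q e ≠ 0) : Function.Injective (L q) := by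
    rw [injective_iff_map_eq_zero]
    intro x hx
    have hx' : orthPart e x + fderiv ℝ f q x • e = 0 := hx
    have h1 : fderiv ℝ f q x = 0 := by
      have := congrArg (fun y => ⟪e, y⟫_ℝ) hx'
      simpa only [inner_add_right, inner_orthPart he, inner_smul_right, hee, inner_zero_right, zero_add,
        mul_one] using this
    have h2 : x = ⟪e, x⟫_ℝ • e := by
      rw [h1, zero_smul, add_zero, orthPart_apply, sub_eq_zero] at hx'
      exact hx'
    rw [h2, map_smul, smul_eq_mul, mul_eq_zero, or_iff_left hq] at h1
    rw [h2, h1, zero_smul]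
  let L' {q} (hq : fderiv ℝ f q e ≠ 0) : Ambient n ≃L[ℝ] Ambient n :=
    (LinearEquiv.ofInjectiveEndo (L q : Ambient n →ₗ[ℝ] Ambient n)
      (hLinj hq)).toContinuousLinearEquiv
  have hL' {q} (hq : fderiv ℝ f q e ≠ 0) : (L' hq : Ambient n →L[ℝ] Ambient n) = L q := rfl
  -- On `V` the derivative of Φ is invertible, which makes the local inverse smooth at every point
  -- used and not only at the image of `p`.
  set V : Set (Ambient n) := {q ∈ U | fderiv ℝ f q e ≠ 0} with hV
  have hVo : IsOpen V := by
    have h1 : ContinuousOn (fun q => fderiv ℝ f q e) U :=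
      ((hf.continuousOn_fderiv_of_isOpen hU (by simp)).clm_apply continuousOn_const)
    exact h1.isOpen_inter_preimage hU isOpen_ne
  have hpV : p ∈ V := ⟨hpU, hfe⟩
  set R := (hΦs.contDiffAt (hU.mem_nhds hpU)).toOpenPartialHomeomorph Φ
    (by rw [hL' hfe]; exact hΦd hpU) (by simp) with hR
  have hRc : (R : Ambient n → Ambient n) = Φ := rfl
  have hpR : p ∈ R.source := ContDiffAt.mem_toOpenPartialHomeomorph_source _ _ _
  have hΦp : Φ p = orthPart e p := by
    have : f p = 0 := (hMU.le ⟨hpM, hpU⟩).2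
    simp [hΦ, this]
  have hpT : orthPart e p ∈ R.target := by
    rw [← hΦp, ← hRc]; exact R.map_source hpR
  have hsymmp : R.symm (orthPart e p) = p := by
    rw [← hΦp, ← hRc]; exact R.left_inv hpR
  obtain ⟨η, hη, hηs⟩ := Metric.isOpen_iff.1 (R.open_source.inter hVo) p ⟨hpR, hpV⟩
  have hcont : ContinuousAt R.symm (orthPart e p) := R.continuousAt_symm hpT
  have hev : ∀ᶠ y in 𝓝 (orthPart e p), y ∈ R.target ∧ R.symm y ∈ V ∧
      |⟪e, R.symm y⟫_ℝ - ⟪e, p⟫_ℝ| < η / 2 := by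
    refine (R.open_target.eventually_mem hpT).and (.and ?_ ?_)
    · exact hcont.eventually (by rw [hsymmp]; exact hVo.mem_nhds hpV)
    · have : ContinuousAt (fun y => |⟪e, R.symm y⟫_ℝ - ⟪e, p⟫_ℝ|) (orthPart e p) :=
        ((continuousAt_const.inner hcont).sub continuousAt_const).abs
      refine this.eventually_lt continuousAt_const ?_
      rw [hsymmp]; simpa using hη
  obtain ⟨δ, hδ, hδs⟩ := Metric.eventually_nhds_iff.1 hev
  have hcyl {x} (hx : x ∈ solidCylinder p e (min δ (η / 2))) :=
    hδs (y := orthPart e x) (by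
      rw [dist_eq_norm, ← map_sub]; exact lt_of_lt_of_le hx (min_le_left _ _))
  have hsymm {x} (hx : x ∈ solidCylinder p e (min δ (η / 2))) :
      R.symm (orthPart e x) = orthPart e x + ⟪e, R.symm (orthPart e x)⟫_ℝ • e ∧
      R.symm (orthPart e x) ∈ M := by
    obtain ⟨hT, hxV, -⟩ := hcyl hx
    have h1 : orthPart e (R.symm (orthPart e x)) + f (R.symm (orthPart e x)) • e = orthPart e x :=
      R.right_inv hT
    have h2 : f (R.symm (orthPart e x)) = 0 := by
      have := congrArg (fun y => ⟪e, y⟫_ℝ) h1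
      simpa only [inner_add_right, inner_orthPart he, inner_smul_right, hee, inner_zero_right, zero_add,
        mul_one] using this
    rw [h2, zero_smul, add_zero] at h1
    refine ⟨?_, (hMU.ge ⟨hxV.1, h2⟩).1⟩
    conv_lhs => rw [← orthPart_add_smul e (R.symm (orthPart e x)), h1]
  -- With radius at most η/2 and half-height η/2, the box lies in the ball of radius η, on which Φ
  -- is injective.
  refine ⟨fun x => ⟪e, R.symm (orthPart e x)⟫_ℝ, min δ (η / 2), η / 2, he,
    lt_min hδ (by linarith), by linarith, ?_, ?_, ?_, ?_, ?_⟩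
  · intro x hx
    obtain ⟨hT, hxV, -⟩ := hcyl hx
    have h1 : ContDiffAt ℝ ∞ R.symm (orthPart e x) :=
      R.contDiffAt_symm (f₀' := L' hxV.2) hT (by rw [hL' hxV.2]; exact hΦd hxV.1)
        (hΦs.contDiffAt (hU.mem_nhds hxV.1))
    exact (contDiffAt_const.inner ℝ
      (h1.comp x (orthPart e).contDiff.contDiffAt)).contDiffWithinAt
  · intro x s
    simp [orthPart_self he]
  · simp only [hsymmp]
  · intro x hx
    exact (hcyl hx).2.2
  · intro x hx hxη
    obtain ⟨hT, hxV, -⟩ := hcyl hx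
    obtain ⟨h1, h2⟩ := hsymm hx
    constructor
    · intro hxM
      have hxb : x ∈ Metric.ball p η := by
        rw [Metric.mem_ball, dist_eq_norm, ← orthPart_add_smul e (x - p)]
        refine (norm_add_le _ _).trans_lt ?_
        rw [norm_smul, he, mul_one, Real.norm_eq_abs]
        have : ‖orthPart e (x - p)‖ < η / 2 := lt_of_lt_of_le hx (min_le_right _ _)
        linarith
      obtain ⟨hxs, hxV'⟩ := hηs hxb
      have hfx : f x = 0 := (hMU.le ⟨hxM, hxV'.1⟩).2
      have h3 : R x = orthPart e x := by rw [hRc]; simp [hΦ, hfx]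
      rw [← h3, R.left_inv hxs]
    · intro hxe
      have : x = R.symm (orthPart e x) := by
        rw [h1, ← hxe, orthPart_add_smul]
      rw [this]
      exact h2

end Graph

/-! ### Normal, tangent space and curvature of a local graph -/

section Graph

variable {n : ℕ}

theorem add_smul_mem_solidCylinder {p e x : Ambient n} {δ : ℝ} (he : ‖e‖ = 1) (s : ℝ) :
    x + s • e ∈ solidCylinder p e δ ↔ x ∈ solidCylinder p e δ := by
  simp [solidCylinder, orthPart_self he]

/-- The projection in the direction `e` to the graph of `g`. -/
noncomputable def graphProj (e : Ambient n) (g : Ambient n → ℝ) (x : Ambient n) : Ambient n :=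
  x + (g x - ⟪e, x⟫_ℝ) • e

/-- The unit normal of the graph of `g` in the direction `e`. -/
noncomputable def graphNormal (e : Ambient n) (g : Ambient n → ℝ) (x : Ambient n) : Ambient n :=
  ‖e - gradient g x‖⁻¹ • (e - gradient g x)

/-- The part of the solid cylinder in which a local graph describes the hypersurface. -/
def graphBox (p e : Ambient n) (δ η : ℝ) : Set (Ambient n) :=
  solidCylinder p e δ ∩ {x | |⟪e, x - p⟫_ℝ| < η}

theorem isOpen_graphBox (p e : Ambient n) (δ η : ℝ) : IsOpen (graphBox p e δ η) :=
  (isOpen_solidCylinder p e δ).inter (isOpen_lt (by fun_prop) continuous_const)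

theorem inner_gradient (g : Ambient n → ℝ) (x v : Ambient n) :
    ⟪gradient g x, v⟫_ℝ = fderiv ℝ g x v := by
  rw [gradient, InnerProductSpace.toDual_symm_apply]

namespace IsLocalGraph

variable {M : Set (Ambient n)} {p e x : Ambient n} {g : Ambient n → ℝ} {δ η : ℝ}

theorem inner_self (h : IsLocalGraph M p e g δ η) : ⟪e, e⟫_ℝ = 1 := by
  rw [real_inner_self_eq_norm_sq, h.norm_eq_one, one_pow]

theorem center_mem_solidCylinder (h : IsLocalGraph M p e g δ η) : p ∈ solidCylinder p e δ := by
  simp [solidCylinder, h.pos]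

theorem center_mem_graphBox (h : IsLocalGraph M p e g δ η) : p ∈ graphBox p e δ η :=
  ⟨h.center_mem_solidCylinder, by simp [h.pos']⟩

theorem inner_graphProj (h : IsLocalGraph M p e g δ η) : ⟪e, graphProj e g x⟫_ℝ = g x := by
  rw [graphProj, inner_add_right, inner_smul_right, h.inner_self]
  ring

theorem graphProj_mem_graphBox (h : IsLocalGraph M p e g δ η) (hx : x ∈ solidCylinder p e δ) :
    graphProj e g x ∈ graphBox p e δ η := by
  refine ⟨(add_smul_mem_solidCylinder h.norm_eq_one _).2 hx, ?_⟩
  rw [mem_ofPred_eq, inner_sub_right, h.inner_graphProj]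
  exact h.abs_sub_lt x hx

theorem apply_graphProj (h : IsLocalGraph M p e g δ η) : g (graphProj e g x) = g x :=
  h.add_smul _ _

theorem graphProj_mem (h : IsLocalGraph M p e g δ η) (hx : x ∈ solidCylinder p e δ) :
    graphProj e g x ∈ M := by
  obtain ⟨h1, h2⟩ := h.graphProj_mem_graphBox hx
  rw [h.mem_iff _ h1 h2, h.inner_graphProj, h.apply_graphProj]

theorem graphProj_eq_self (h : IsLocalGraph M p e g δ η) (hx : x ∈ M ∩ graphBox p e δ η) :
    graphProj e g x = x := by
  rw [graphProj, ← (h.mem_iff x hx.2.1 hx.2.2).1 hx.1, sub_self, zero_smul, add_zero]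

theorem center_mem (h : IsLocalGraph M p e g δ η) : p ∈ M := by
  rw [h.mem_iff p h.center_mem_solidCylinder h.center_mem_graphBox.2, h.apply_center]

theorem graphProj_center (h : IsLocalGraph M p e g δ η) : graphProj e g p = p :=
  h.graphProj_eq_self ⟨h.center_mem, h.center_mem_graphBox⟩

theorem differentiableAt (h : IsLocalGraph M p e g δ η) (hx : x ∈ solidCylinder p e δ) :
    DifferentiableAt ℝ g x :=
  h.contDiffOn.differentiableAt_of_isOpen (isOpen_solidCylinder p e δ) hx

theorem fderiv_add_smul (h : IsLocalGraph M p e g δ η) (x : Ambient n) (s : ℝ) :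
    fderiv ℝ g (x + s • e) = fderiv ℝ g x := by
  rw [← fderiv_comp_add_right]
  simp only [h.add_smul]

theorem fderiv_apply_direction (h : IsLocalGraph M p e g δ η) (hx : x ∈ solidCylinder p e δ) :
    fderiv ℝ g x e = 0 := by
  have h1 : HasDerivAt (fun t : ℝ => x + t • e) e 0 := by
    simpa using ((hasDerivAt_id (0 : ℝ)).smul_const e).const_add x
  have h2 : HasFDerivAt g (fderiv ℝ g x) (x + (0 : ℝ) • e) := by
    simpa using (h.differentiableAt hx).hasFDerivAt
  have h3 := h2.comp_hasDerivAt 0 h1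
  have h4 : g ∘ (fun t : ℝ => x + t • e) = fun _ => g x := funext fun t => h.add_smul x t
  rw [h4] at h3
  exact h3.unique (hasDerivAt_const _ _)

theorem contDiffOn_gradient (h : IsLocalGraph M p e g δ η) :
    ContDiffOn ℝ ∞ (fun x => gradient g x) (solidCylinder p e δ) :=
  (InnerProductSpace.toDual ℝ (Ambient n)).symm.contDiff.comp_contDiffOn
    (h.contDiffOn.fderiv_of_isOpen (isOpen_solidCylinder p e δ) (by simp))

theorem inner_gradient_direction (h : IsLocalGraph M p e g δ η) (hx : x ∈ solidCylinder p e δ) :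
    ⟪e, gradient g x⟫_ℝ = 0 := by
  rw [real_inner_comm, inner_gradient, h.fderiv_apply_direction hx]

theorem inner_sub_gradient (h : IsLocalGraph M p e g δ η) (hx : x ∈ solidCylinder p e δ) :
    ⟪e, e - gradient g x⟫_ℝ = 1 := by
  rw [inner_sub_right, h.inner_gradient_direction hx, h.inner_self, sub_zero]

theorem norm_sub_gradient_pos (h : IsLocalGraph M p e g δ η) (hx : x ∈ solidCylinder p e δ) :
    0 < ‖e - gradient g x‖ := by
  refine norm_pos_iff.2 fun h0 => ?_
  have := h.inner_sub_gradient hx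
  rw [h0, inner_zero_right] at this
  exact zero_ne_one this

theorem contDiffOn_graphNormal (h : IsLocalGraph M p e g δ η) :
    ContDiffOn ℝ ∞ (graphNormal e g) (solidCylinder p e δ) := by
  have h1 : ContDiffOn ℝ ∞ (fun x => e - gradient g x) (solidCylinder p e δ) :=
    contDiffOn_const.sub h.contDiffOn_gradient
  have h2 := fun x hx => norm_pos_iff.1 (h.norm_sub_gradient_pos (x := x) hx)
  exact ((h1.norm ℝ h2).inv fun x hx => (h.norm_sub_gradient_pos hx).ne').smul h1

theorem norm_graphNormal (h : IsLocalGraph M p e g δ η) (hx : x ∈ solidCylinder p e δ) :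
    ‖graphNormal e g x‖ = 1 := by
  rw [graphNormal, norm_smul, norm_inv, norm_norm, inv_mul_cancel₀ (h.norm_sub_gradient_pos hx).ne']

theorem graphNormal_add_smul (h : IsLocalGraph M p e g δ η) (x : Ambient n) (s : ℝ) :
    graphNormal e g (x + s • e) = graphNormal e g x := by
  simp only [graphNormal, gradient, h.fderiv_add_smul]

theorem graphNormal_graphProj (h : IsLocalGraph M p e g δ η) (x : Ambient n) :
    graphNormal e g (graphProj e g x) = graphNormal e g x :=
  h.graphNormal_add_smul _ _

theorem fderiv_graphNormal_graphProj (h : IsLocalGraph M p e g δ η) (x : Ambient n) :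
    fderiv ℝ (graphNormal e g) (graphProj e g x) = fderiv ℝ (graphNormal e g) x := by
  rw [graphProj, ← fderiv_comp_add_right]
  simp only [h.graphNormal_add_smul]

theorem fderiv_graphNormal_direction (h : IsLocalGraph M p e g δ η)
    (hx : x ∈ solidCylinder p e δ) : fderiv ℝ (graphNormal e g) x e = 0 := by
  have h1 : HasDerivAt (fun t : ℝ => x + t • e) e 0 := by
    simpa using ((hasDerivAt_id (0 : ℝ)).smul_const e).const_add x
  have h2 : HasFDerivAt (graphNormal e g) (fderiv ℝ (graphNormal e g) x) (x + (0 : ℝ) • e) := by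
    simpa using (h.contDiffOn_graphNormal.differentiableAt_of_isOpen
      (isOpen_solidCylinder p e δ) hx).hasFDerivAt
  have h3 := h2.comp_hasDerivAt 0 h1
  have h4 : graphNormal e g ∘ (fun t : ℝ => x + t • e) = fun _ => graphNormal e g x :=
    funext fun t => h.graphNormal_add_smul x t
  rw [h4] at h3
  exact h3.unique (hasDerivAt_const _ _)

theorem inner_graphNormal_fderiv (h : IsLocalGraph M p e g δ η)
    (hx : x ∈ solidCylinder p e δ) (v : Ambient n) :
    ⟪graphNormal e g x, fderiv ℝ (graphNormal e g) x v⟫_ℝ = 0 := by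
  have hD := isOpen_solidCylinder p e δ
  have h1 := dirDeriv_inner hD h.contDiffOn_graphNormal h.contDiffOn_graphNormal v hx
  rw [dirDeriv_eq_zero_of_const hD (k := 1) (fun y hy => by
    rw [real_inner_self_eq_norm_sq, h.norm_graphNormal hy, one_pow]) v hx,
    real_inner_comm (graphNormal e g x)] at h1
  unfold dirDeriv at h1
  linarith

theorem inner_graphNormal_eq_zero_iff (h : IsLocalGraph M p e g δ η)
    (hx : x ∈ solidCylinder p e δ) (v : Ambient n) :
    ⟪graphNormal e g x, v⟫_ℝ = 0 ↔ fderiv ℝ g x v = ⟪e, v⟫_ℝ := by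
  rw [graphNormal, inner_smul_left, mul_eq_zero, or_iff_right, inner_sub_left, inner_gradient,
    sub_eq_zero, eq_comm]
  simpa using (norm_pos_iff.1 (h.norm_sub_gradient_pos hx))

theorem hasFDerivAt_graphProj (h : IsLocalGraph M p e g δ η) (hx : x ∈ solidCylinder p e δ) :
    HasFDerivAt (graphProj e g)
      (ContinuousLinearMap.id ℝ _ + (fderiv ℝ g x - innerSL ℝ e).smulRight e) x :=
  (hasFDerivAt_id x).add
    (((h.differentiableAt hx).hasFDerivAt.sub (innerSL ℝ e).hasFDerivAt).smul_const e)

theorem dirDeriv_graphProj (h : IsLocalGraph M p e g δ η) (hx : x ∈ solidCylinder p e δ)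
    (v : Ambient n) :
    dirDeriv v (graphProj e g) x = v + (fderiv ℝ g x v - ⟪e, v⟫_ℝ) • e := by
  simp [dirDeriv, (h.hasFDerivAt_graphProj hx).fderiv]

theorem inner_graphNormal_dirDeriv_graphProj (h : IsLocalGraph M p e g δ η)
    (hx : x ∈ solidCylinder p e δ) (v : Ambient n) :
    ⟪graphNormal e g x, dirDeriv v (graphProj e g) x⟫_ℝ = 0 := by
  rw [h.inner_graphNormal_eq_zero_iff hx, h.dirDeriv_graphProj hx, map_add, map_smul,
    h.fderiv_apply_direction hx, inner_add_right, inner_smul_right, h.inner_self]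
  simp

/-- The velocity of the lift of a line through `x` is a tangent vector. -/
theorem dirDeriv_graphProj_mem_tangentSubspace (h : IsLocalGraph M p e g δ η)
    (hx : x ∈ solidCylinder p e δ) (v : Ambient n) :
    dirDeriv v (graphProj e g) x ∈ tangentSubspace M (graphProj e g x) := by
  have h1 : HasDerivAt (fun t : ℝ => x + t • v) v 0 := by
    simpa using ((hasDerivAt_id (0 : ℝ)).smul_const v).const_add x
  refine Submodule.subset_span ⟨fun t => graphProj e g (x + t • v), by simp, ?_, ?_⟩
  · have : ∀ᶠ t : ℝ in 𝓝 0, x + t • v ∈ solidCylinder p e δ :=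
      h1.continuousAt.eventually (by simpa using (isOpen_solidCylinder p e δ).mem_nhds hx)
    filter_upwards [this] with t ht using h.graphProj_mem ht
  · have h2 : HasFDerivAt (graphProj e g) (fderiv ℝ (graphProj e g) x) (x + (0 : ℝ) • v) := by
      simpa using (h.hasFDerivAt_graphProj hx).differentiableAt.hasFDerivAt
    exact h2.comp_hasDerivAt 0 h1

/-- Differentiating ⟨e, γ⟩ = g(γ) along a curve in M gives one direction. Conversely, if `v` is
orthogonal to the normal, the lift of the line through `x` in the direction `v` has velocity exactly
`v`. -/
theorem mem_tangentSubspace_iff (h : IsLocalGraph M p e g δ η) (hx : x ∈ M ∩ graphBox p e δ η)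
    (v : Ambient n) : v ∈ tangentSubspace M x ↔ ⟪graphNormal e g x, v⟫_ℝ = 0 := by
  constructor
  · intro hv
    induction hv using Submodule.span_induction with
    | mem v hv =>
      obtain ⟨γ, rfl, hγM, hγ⟩ := hv
      rw [h.inner_graphNormal_eq_zero_iff hx.2.1]
      have h1 := (h.differentiableAt hx.2.1).hasFDerivAt.comp_hasDerivAt 0 hγ
      have h2 : HasDerivAt (fun t => ⟪e, γ t⟫_ℝ) ⟪e, v⟫_ℝ 0 := by
        simpa using (hasDerivAt_const (0 : ℝ) e).inner ℝ hγ
      refine h1.unique (h2.congr_of_eventuallyEq ?_)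
      filter_upwards [hγM, hγ.continuousAt.eventually
        ((isOpen_graphBox p e δ η).mem_nhds hx.2)] with t ht ht'
      exact ((h.mem_iff _ ht'.1 ht'.2).1 ht).symm
    | zero => exact inner_zero_right _
    | add x y _ _ hx hy => rw [inner_add_right, hx, hy, add_zero]
    | smul a x _ hx => rw [inner_smul_right, hx, mul_zero]
  · intro hv
    have h1 := h.dirDeriv_graphProj_mem_tangentSubspace hx.2.1 v
    rwa [h.graphProj_eq_self hx, h.dirDeriv_graphProj hx.2.1,
      (h.inner_graphNormal_eq_zero_iff hx.2.1 v).1 hv, sub_self, zero_smul, add_zero] at h1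

theorem isUnitNormalField (h : IsLocalGraph M p e g δ η) :
    IsUnitNormalField M (graphBox p e δ η) (graphNormal e g) where
  isOpen := isOpen_graphBox p e δ η
  contDiffOn := h.contDiffOn_graphNormal.mono inter_subset_left
  norm_eq_one _ hq := h.norm_graphNormal hq.2.1
  inner_eq_zero _ hq v hv := (h.mem_tangentSubspace_iff hq v).1 hv

/-- The derivative of a unit field is orthogonal to the field, so the normal direction adds nothing
to the trace and the ambient divergence computes H. -/
theorem meanCurvature_eq (h : IsLocalGraph M p e g δ η) {ι : Type*} [Fintype ι]
    (b : OrthonormalBasis ι ℝ (Ambient n)) (hx : x ∈ M ∩ graphBox p e δ η) :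
    meanCurvature M (graphNormal e g) x = ∑ i, ⟪dirDeriv (b i) (graphNormal e g) x, b i⟫_ℝ := by
  have h1 := (stdOrthonormalBasis ℝ (tangentSubspace M x)).sum_inner_add_inner_eq b
    (h.norm_graphNormal hx.2.1) (h.mem_tangentSubspace_iff hx) (fderiv ℝ (graphNormal e g) x)
  rw [real_inner_comm (graphNormal e g x), h.inner_graphNormal_fderiv hx.2.1, add_zero] at h1
  exact h1

theorem norm_sq_fderiv_graphNormal_eq (h : IsLocalGraph M p e g δ η) (hx : x ∈ M ∩ graphBox p e δ η)
    (u : Ambient n) :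
    ∑ j, ⟪fderiv ℝ (graphNormal e g) x u,
      (stdOrthonormalBasis ℝ (tangentSubspace M x) j : Ambient n)⟫_ℝ ^ 2 =
    ‖fderiv ℝ (graphNormal e g) x u‖ ^ 2 := by
  have h1 := (stdOrthonormalBasis ℝ (tangentSubspace M x)).sum_inner_sq_eq_norm_sq
    (h.norm_graphNormal hx.2.1) (h.mem_tangentSubspace_iff hx) (fderiv ℝ (graphNormal e g) x u)
  rwa [real_inner_comm (graphNormal e g x), h.inner_graphNormal_fderiv hx.2.1, zero_pow two_ne_zero,
    add_zero] at h1

theorem normSqSecondFundamentalForm_eq (h : IsLocalGraph M p e g δ η)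
    (hx : x ∈ M ∩ graphBox p e δ η) :
    normSqSecondFundamentalForm M (graphNormal e g) x = ∑ i, ‖fderiv ℝ (graphNormal e g) x
      (stdOrthonormalBasis ℝ (tangentSubspace M x) i : Ambient n)‖ ^ 2 :=
  Finset.sum_congr rfl fun _ _ => h.norm_sq_fderiv_graphNormal_eq hx _

/-- The operator norm is at most the Hilbert-Schmidt norm, by Cauchy-Schwarz. -/
theorem norm_sq_fderiv_graphNormal_le (h : IsLocalGraph M p e g δ η)
    (hx : x ∈ M ∩ graphBox p e δ η) {u : Ambient n} (hu : u ∈ tangentSubspace M x) :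
    ‖fderiv ℝ (graphNormal e g) x u‖ ^ 2 ≤
      normSqSecondFundamentalForm M (graphNormal e g) x * ‖u‖ ^ 2 := by
  set t := stdOrthonormalBasis ℝ (tangentSubspace M x)
  set L := fderiv ℝ (graphNormal e g) x
  have h1 : u = ∑ i, ⟪(t i : Ambient n), u⟫_ℝ • (t i : Ambient n) := by
    simpa using (congrArg Subtype.val (t.sum_repr' ⟨u, hu⟩)).symm
  have h2 : ∑ i, ⟪(t i : Ambient n), u⟫_ℝ ^ 2 = ‖u‖ ^ 2 := by
    simpa using t.sum_sq_norm_inner_right ⟨u, hu⟩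
  have h3 : ‖L u‖ ≤ ∑ i, |⟪(t i : Ambient n), u⟫_ℝ| * ‖L (t i)‖ := by
    conv_lhs => rw [h1, map_sum]
    refine (norm_sum_le _ _).trans (Finset.sum_le_sum fun i _ => ?_)
    rw [map_smul, norm_smul, Real.norm_eq_abs]
  rw [h.normSqSecondFundamentalForm_eq hx]
  calc ‖L u‖ ^ 2 ≤ (∑ i, |⟪(t i : Ambient n), u⟫_ℝ| * ‖L (t i)‖) ^ 2 := by gcongr
    _ ≤ (∑ i, |⟪(t i : Ambient n), u⟫_ℝ| ^ 2) * ∑ i, ‖L (t i)‖ ^ 2 :=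
      Finset.sum_mul_sq_le_sq_mul_sq _ _ _
    _ = _ := by simp only [sq_abs, h2]; ring

end IsLocalGraph

theorem fderiv_eq_zero_of_mem_tangentSubspace {M U : Set (Ambient n)} {f : Ambient n → ℝ}
    (hU : IsOpen U) (hf : ContDiffOn ℝ ∞ f U) (hMU : M ∩ U = {q ∈ U | f q = 0}) {p v : Ambient n}
    (hpU : p ∈ U) (hv : v ∈ tangentSubspace M p) : fderiv ℝ f p v = 0 := by
  induction hv using Submodule.span_induction with
  | mem v hv =>
    obtain ⟨γ, rfl, hγM, hγ⟩ := hv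
    have h1 := (hf.differentiableAt_of_isOpen hU hpU).hasFDerivAt.comp_hasDerivAt 0 hγ
    refine h1.unique ((hasDerivAt_const (0 : ℝ) (0 : ℝ)).congr_of_eventuallyEq ?_)
    filter_upwards [hγM, hγ.continuousAt.eventually (hU.mem_nhds hpU)] with t ht ht'
    exact (hMU.le ⟨ht, ht'⟩).2
  | zero => exact map_zero _
  | add x y _ _ hx hy => rw [map_add, hx, hy, add_zero]
  | smul a x _ hx => rw [map_smul, hx, smul_zero]

/-- Write M as a graph in a direction transversal to the kernel of the differential. The lift of the
line in the direction `v` has velocity `v` plus a multiple of the transversal vector; the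
differential kills both `v` and the velocity, so the multiple is zero. -/
theorem mem_tangentSubspace_of_fderiv_eq_zero {M U : Set (Ambient n)} {f : Ambient n → ℝ}
    (hU : IsOpen U) (hf : ContDiffOn ℝ ∞ f U) (hMU : M ∩ U = {q ∈ U | f q = 0}) {p v : Ambient n}
    (hpM : p ∈ M) (hpU : p ∈ U) (hne : fderiv ℝ f p ≠ 0) (hv : fderiv ℝ f p v = 0) :
    v ∈ tangentSubspace M p := by
  obtain ⟨w, hw⟩ : ∃ w, fderiv ℝ f p w ≠ 0 := by
    by_contra! h
    exact hne (ContinuousLinearMap.ext h)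
  have hw0 : w ≠ 0 := by rintro rfl; simp at hw
  obtain ⟨g, δ, η, h⟩ := exists_isLocalGraph_of_fderiv_ne_zero hU hf hMU hpM hpU
    (e := ‖w‖⁻¹ • w) (by rw [norm_smul, norm_inv, norm_norm, inv_mul_cancel₀ (norm_ne_zero_iff.2 hw0)])
    (by rw [map_smul, smul_eq_mul]; exact mul_ne_zero (inv_ne_zero (norm_ne_zero_iff.2 hw0)) hw)
  have h1 := h.dirDeriv_graphProj_mem_tangentSubspace h.center_mem_solidCylinder v
  rw [h.graphProj_center, h.dirDeriv_graphProj h.center_mem_solidCylinder] at h1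
  have h2 := fderiv_eq_zero_of_mem_tangentSubspace hU hf hMU hpU h1
  rw [map_add, hv, zero_add, map_smul, smul_eq_mul, mul_eq_zero, or_iff_left (by
    rw [map_smul, smul_eq_mul]
    exact mul_ne_zero (inv_ne_zero (norm_ne_zero_iff.2 hw0)) hw)] at h2
  rwa [h2, zero_smul, add_zero] at h1

theorem IsSmoothHypersurface.exists_isLocalGraph {M : Set (Ambient n)}
    (hM : IsSmoothHypersurface M) {p e : Ambient n} (hp : p ∈ M) (he : ‖e‖ = 1)
    (heT : e ∉ tangentSubspace M p) : ∃ g δ η, IsLocalGraph M p e g δ η := by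
  obtain ⟨U, f, hU, hpU, hf, hne, hMU⟩ := hM p hp
  exact exists_isLocalGraph_of_fderiv_ne_zero hU hf hMU hp hpU he fun h0 =>
    heT (mem_tangentSubspace_of_fderiv_eq_zero hU hf hMU hp hpU (hne p hpU) h0)

theorem IsSmoothHypersurface.exists_unit_normal {M : Set (Ambient n)}
    (hM : IsSmoothHypersurface M) {p : Ambient n} (hp : p ∈ M) :
    ∃ e : Ambient n, ‖e‖ = 1 ∧ ∀ v, v ∈ tangentSubspace M p ↔ ⟪e, v⟫_ℝ = 0 := by
  obtain ⟨U, f, hU, hpU, hf, hne, hMU⟩ := hM p hp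
  have hg : gradient f p ≠ 0 := fun h =>
    hne p hpU ((InnerProductSpace.toDual ℝ (Ambient n)).symm.map_eq_zero_iff.1 h)
  refine ⟨‖gradient f p‖⁻¹ • gradient f p, ?_, fun v => ?_⟩
  · rw [norm_smul, norm_inv, norm_norm, inv_mul_cancel₀ (norm_ne_zero_iff.2 hg)]
  · rw [inner_smul_left, inner_gradient, mul_eq_zero, or_iff_right (by simpa using hg)]
    exact ⟨fderiv_eq_zero_of_mem_tangentSubspace hU hf hMU hpU,
      mem_tangentSubspace_of_fderiv_eq_zero hU hf hMU hp hpU (hne p hpU)⟩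

/-- A unit vector orthogonal to a hyperplane is plus or minus any other. -/
theorem eq_or_eq_neg_of_orthogonal {T : Submodule ℝ (Ambient n)} {e ν : Ambient n} (he : ‖e‖ = 1)
    (hT : ∀ v, v ∈ T ↔ ⟪e, v⟫_ℝ = 0) (hν : ‖ν‖ = 1) (hνT : ∀ v ∈ T, ⟪ν, v⟫_ℝ = 0) :
    ν = e ∨ ν = -e := by
  have h1 := hνT (orthPart e ν) ((hT _).2 (inner_orthPart he ν))
  have h2 : orthPart e ν = 0 := by
    rw [← inner_self_eq_zero (𝕜 := ℝ), ← h1]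
    nth_rw 1 [orthPart_apply]
    rw [inner_sub_left, inner_smul_left, inner_orthPart he, mul_zero, sub_zero]
  have h3 : ⟪e, ν⟫_ℝ ^ 2 = 1 := by
    have := norm_sq_eq_orthPart he ν
    rw [h2, hν] at this
    simpa using this.symm
  have h4 : ν = ⟪e, ν⟫_ℝ • e := by
    conv_lhs => rw [← orthPart_add_smul e ν, h2, zero_add]
  rcases sq_eq_sq_iff_eq_or_eq_neg.1 (h3.trans (one_pow 2).symm) with h | h <;> rw [h] at h4
  · left; simpa using h4
  · right; simpa using h4

theorem IsSmoothHypersurface.mem_tangentSubspace_iff {M U : Set (Ambient n)}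
    (hM : IsSmoothHypersurface M) {ν : Ambient n → Ambient n} (hν : IsUnitNormalField M U ν)
    {p : Ambient n} (hp : p ∈ M ∩ U) (v : Ambient n) :
    v ∈ tangentSubspace M p ↔ ⟪ν p, v⟫_ℝ = 0 := by
  obtain ⟨e, he, hT⟩ := hM.exists_unit_normal hp.1
  rw [hT]
  rcases eq_or_eq_neg_of_orthogonal he hT (hν.norm_eq_one p hp) (hν.inner_eq_zero p hp) with h | h
  · rw [h]
  · rw [h, inner_neg_left, neg_eq_zero]

/-- The squared norm of the component of `v` normal to `M` at `p`. -/
noncomputable def normalSq (M : Set (Ambient n)) (p v : Ambient n) : ℝ :=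
  ‖v - (tangentSubspace M p).starProjection v‖ ^ 2

theorem normalSq_eq {M : Set (Ambient n)} {p e : Ambient n} (he : ‖e‖ = 1)
    (hT : ∀ v, v ∈ tangentSubspace M p ↔ ⟪e, v⟫_ℝ = 0) (v : Ambient n) :
    normalSq M p v = ⟪e, v⟫_ℝ ^ 2 := by
  have h1 : (tangentSubspace M p).starProjection v = orthPart e v := by
    refine Submodule.eq_starProjection_of_mem_of_inner_eq_zero ((hT _).2 (inner_orthPart he v)) ?_
    intro w hw
    rw [orthPart_apply, sub_sub_cancel, inner_smul_left, (hT w).1 hw, mul_zero]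
  rw [normalSq, h1, orthPart_apply, sub_sub_cancel, norm_smul, he]
  simp

theorem IsLocalGraph.normalSq_eq {M : Set (Ambient n)} {p e x : Ambient n} {g : Ambient n → ℝ}
    {δ η : ℝ} (h : IsLocalGraph M p e g δ η) (hx : x ∈ M ∩ graphBox p e δ η) (v : Ambient n) :
    normalSq M x v = ⟪graphNormal e g x, v⟫_ℝ ^ 2 :=
  _root_.normalSq_eq (h.norm_graphNormal hx.2.1) (h.mem_tangentSubspace_iff hx) v

end Graph

/-! ### Closed self-shrinkers with |A|² < 1: vanishing of H and rigidity -/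

section SelfShrinker

variable {n : ℕ} {M : Set (Ambient n)}

theorem IsLocalGraph.graphNormal_center {p e : Ambient n} {g : Ambient n → ℝ}
    {δ η : ℝ} (h : IsLocalGraph M p e g δ η)
    (hT : ∀ v, v ∈ tangentSubspace M p ↔ ⟪e, v⟫_ℝ = 0) : graphNormal e g p = e := by
  have hp := h.center_mem_solidCylinder
  rcases eq_or_eq_neg_of_orthogonal h.norm_eq_one hT (h.norm_graphNormal hp) fun v hv =>
    (h.mem_tangentSubspace_iff ⟨h.center_mem, h.center_mem_graphBox⟩ v).1 hv with h1 | h1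
  · exact h1
  · have h2 : 0 ≤ ⟪e, graphNormal e g p⟫_ℝ := by
      rw [graphNormal, inner_smul_right, h.inner_sub_gradient hp]
      simp
    rw [h1, inner_neg_right, h.inner_self] at h2
    norm_num at h2

theorem notMem_of_unit_normal {T : Submodule ℝ (Ambient n)} {e : Ambient n} (he : ‖e‖ = 1)
    (hT : ∀ v, v ∈ T ↔ ⟪e, v⟫_ℝ = 0) : e ∉ T := by
  rw [hT, real_inner_self_eq_norm_sq, he]
  norm_num

/-- Each point of a hypersurface is the center of a local graph over the tangent space. -/
theorem IsSmoothHypersurface.exists_isLocalGraph_normal (hM : IsSmoothHypersurface M)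
    {p : Ambient n} (hp : p ∈ M) : ∃ e g δ η, IsLocalGraph M p e g δ η ∧ graphNormal e g p = e := by
  obtain ⟨e, he, hT⟩ := hM.exists_unit_normal hp
  obtain ⟨g, δ, η, h⟩ := hM.exists_isLocalGraph hp he (notMem_of_unit_normal he hT)
  exact ⟨e, g, δ, η, h, h.graphNormal_center hT⟩

theorem IsSelfShrinker.inner_graphProj_graphNormal (hS : IsSelfShrinker M) {p e : Ambient n}
    {g : Ambient n → ℝ} {δ η : ℝ} (h : IsLocalGraph M p e g δ η) {ι : Type*} [Fintype ι]
    (b : OrthonormalBasis ι ℝ (Ambient n)) {x : Ambient n} (hx : x ∈ solidCylinder p e δ) :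
    ⟪graphProj e g x, graphNormal e g x⟫_ℝ =
      ∑ i, ⟪dirDeriv (b i) (graphNormal e g) x, b i⟫_ℝ := by
  have hq : graphProj e g x ∈ M ∩ graphBox p e δ η :=
    ⟨h.graphProj_mem hx, h.graphProj_mem_graphBox hx⟩
  have h1 := hS _ _ h.isUnitNormalField _ hq
  rw [h.meanCurvature_eq b hq, h.graphNormal_graphProj] at h1
  rw [← h1]
  simp only [dirDeriv, h.fderiv_graphNormal_graphProj]

/-- This is `maximum_principle` in the graph over the tangent plane at the maximum point. The
projection to the graph turns a maximum on M into a local maximum on an open set of the ambient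
space. -/
theorem IsSelfShrinker.normalSq_mul_le (hM : IsSmoothHypersurface M) (hS : IsSelfShrinker M)
    {p : Ambient n} (hp : p ∈ M) {ε : ℝ}
    (hmax : ∀ x ∈ M, normalSq M x x - ε * ‖x‖ ^ 2 ≤ normalSq M p p - ε * ‖p‖ ^ 2) :
    ∃ U ν, IsUnitNormalField M U ν ∧ p ∈ U ∧
      normalSq M p p * (1 - normSqSecondFundamentalForm M ν p) ≤ ε * (n - ‖p‖ ^ 2) := by
  obtain ⟨e, g, δ, η, h, hp1⟩ := hM.exists_isLocalGraph_normal hp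
  have hpB : p ∈ M ∩ graphBox p e δ η := ⟨hp, h.center_mem_graphBox⟩
  refine ⟨_, _, h.isUnitNormalField, hpB.2, ?_⟩
  set b := EuclideanSpace.basisFun (Fin (n + 1)) ℝ
  have hsq {x : Ambient n} (hx : x ∈ solidCylinder p e δ) :
      normalSq M (graphProj e g x) (graphProj e g x) =
        ⟪graphProj e g x, graphNormal e g x⟫_ℝ ^ 2 := by
    rw [h.normalSq_eq ⟨h.graphProj_mem hx, h.graphProj_mem_graphBox hx⟩, h.graphNormal_graphProj,
      real_inner_comm]
  have key := maximum_principle b (isOpen_solidCylinder p e δ) h.center_mem_solidCylinder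
    h.norm_eq_one h.contDiffOn_graphNormal
    (h.contDiffOn.sub (innerSL ℝ e).contDiff.contDiffOn) (r := graphProj e g) (fun _ => rfl)
    h.graphProj_center hp1 (fun _ hx => h.norm_graphNormal hx)
    (fun _ hx => h.inner_graphNormal_dirDeriv_graphProj hx)
    (fun _ hx => h.fderiv_graphNormal_direction hx)
    (fun _ hx => hS.inner_graphProj_graphNormal h b hx) (ε := ε) (by
      filter_upwards [(isOpen_solidCylinder p e δ).mem_nhds h.center_mem_solidCylinder] with x hx
      rw [← hsq hx, ← hsq h.center_mem_solidCylinder, real_inner_self_eq_norm_sq,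
        real_inner_self_eq_norm_sq, h.graphProj_center]
      exact hmax _ (h.graphProj_mem hx))
  have hA := (stdOrthonormalBasis ℝ (tangentSubspace M p)).sum_norm_sq_add_norm_sq_eq b
    (h.norm_graphNormal hpB.2.1) (h.mem_tangentSubspace_iff hpB) (fderiv ℝ (graphNormal e g) p)
  rw [← h.normSqSecondFundamentalForm_eq hpB, hp1, h.fderiv_graphNormal_direction hpB.2.1] at hA
  have hA' : normSqSecondFundamentalForm M (graphNormal e g) p =
      ∑ i, ‖dirDeriv (b i) (graphNormal e g) p‖ ^ 2 := by
    rw [← add_zero (normSqSecondFundamentalForm M (graphNormal e g) p)]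
    simpa [dirDeriv] using hA
  rw [h.normalSq_eq hpB, hp1, hA', real_inner_comm]
  simpa using key

/-- By Cauchy-Schwarz, H² ≤ n ∑ A(tᵢ, tᵢ)² ≤ n|A|². -/
theorem IsSelfShrinker.normalSq_self_le (hM : IsSmoothHypersurface M) (hS : IsSelfShrinker M)
    (hA : ∀ U ν, IsUnitNormalField M U ν → ∀ p ∈ M ∩ U, normSqSecondFundamentalForm M ν p < 1)
    {p : Ambient n} (hp : p ∈ M) : normalSq M p p ≤ n := by
  obtain ⟨U, ν, hν, hpU⟩ := hM.exists_isUnitNormalField hp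
  have hT := hM.mem_tangentSubspace_iff hν ⟨hp, hpU⟩
  have h1 := hν.norm_eq_one p ⟨hp, hpU⟩
  have hcard : Module.finrank ℝ (tangentSubspace M p) ≤ n := by
    have hne : tangentSubspace M p ≠ ⊤ := fun h0 =>
      notMem_of_unit_normal h1 hT (h0 ▸ Submodule.mem_top)
    have := Submodule.finrank_lt hne
    simp at this
    omega
  rw [normalSq_eq h1 hT, real_inner_comm, ← hS U ν hν p ⟨hp, hpU⟩]
  set t := stdOrthonormalBasis ℝ (tangentSubspace M p)
  calc meanCurvature M ν p ^ 2
      ≤ (Module.finrank ℝ (tangentSubspace M p) : ℝ) *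
          ∑ i, secondFundamentalForm M ν p (t i) (t i) ^ 2 := by
        have := sq_sum_le_card_mul_sum_sq (s := Finset.univ)
          (f := fun i => secondFundamentalForm M ν p (t i) (t i))
        simpa [meanCurvature] using this
    _ ≤ n * normSqSecondFundamentalForm M ν p := by
        gcongr
        · refine Finset.sum_le_sum fun i _ => ?_
          exact Finset.single_le_sum (f := fun j => secondFundamentalForm M ν p (t i) (t j) ^ 2)
            (fun j _ => sq_nonneg _) (Finset.mem_univ i)
    _ ≤ n * 1 := by
        gcongr
        exact (hA U ν hν p ⟨hp, hpU⟩).le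
    _ = n := mul_one _

theorem IsSmoothHypersurface.continuousOn_normalSq_self (hM : IsSmoothHypersurface M) :
    ContinuousOn (fun p => normalSq M p p) M := by
  intro p hp
  obtain ⟨e, g, δ, η, h, -⟩ := hM.exists_isLocalGraph_normal hp
  have h1 : ContinuousAt (fun x => ⟪graphNormal e g x, x⟫_ℝ ^ 2) p :=
    (((h.contDiffOn_graphNormal.continuousOn).continuousAt ((isOpen_solidCylinder p e δ).mem_nhds
      h.center_mem_solidCylinder)).inner continuousAt_id).pow 2
  refine h1.continuousWithinAt.congr_of_eventuallyEq ?_ ?_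
  · filter_upwards [self_mem_nhdsWithin, mem_nhdsWithin_of_mem_nhds
      ((isOpen_graphBox p e δ η).mem_nhds h.center_mem_graphBox)] with x hx hx'
    exact h.normalSq_eq ⟨hx, hx'⟩ x
  · exact h.normalSq_eq ⟨hp, h.center_mem_graphBox⟩ p

/-- A proper self-shrinker with `|A|² < 1` has vanishing mean curvature. -/
theorem IsSelfShrinker.normalSq_self_eq_zero (hM : IsSmoothHypersurface M) (hS : IsSelfShrinker M)
    (hA : ∀ U ν, IsUnitNormalField M U ν → ∀ p ∈ M ∩ U, normSqSecondFundamentalForm M ν p < 1)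
    (hcl : IsClosed M) {p : Ambient n} (hp : p ∈ M) : normalSq M p p = 0 := by
  have hcont := hM.continuousOn_normalSq_self
  have hnn (x : Ambient n) : 0 ≤ normalSq M x x := sq_nonneg _
  have hε {ε : ℝ} (hε : 0 < ε) : ∃ q ∈ M, ‖q‖ ^ 2 ≤ n ∧
      ∀ x ∈ M, normalSq M x x - ε * ‖x‖ ^ 2 ≤ normalSq M q q := by
    -- If |x| > R, then H² − ε|x|² < n − (n + ε|p|²) = −ε|p|², which does not exceed the value at
    -- `p`. The maximum over the ball of radius R is therefore global.
    set R := √((n + ε * ‖p‖ ^ 2) / ε) with hR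
    have hpR : ‖p‖ ≤ R := by
      refine Real.le_sqrt_of_sq_le ?_
      rw [le_div_iff₀ hε]
      nlinarith [Nat.cast_nonneg (α := ℝ) n]
    have hK : IsCompact (M ∩ Metric.closedBall 0 R) :=
      (isCompact_closedBall (0 : Ambient n) R).inter_left hcl
    obtain ⟨q, hq, hqmax⟩ := hK.exists_isMaxOn (f := fun x => normalSq M x x - ε * ‖x‖ ^ 2)
      ⟨p, hp, by simpa using hpR⟩ ((hcont.mono inter_subset_left).sub (by fun_prop))
    have hmax : ∀ x ∈ M, normalSq M x x - ε * ‖x‖ ^ 2 ≤ normalSq M q q - ε * ‖q‖ ^ 2 := by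
      intro x hx
      by_cases hxR : ‖x‖ ≤ R
      · exact hqmax ⟨hx, by simpa using hxR⟩
      · have h1 : normalSq M p p - ε * ‖p‖ ^ 2 ≤ normalSq M q q - ε * ‖q‖ ^ 2 :=
          hqmax ⟨hp, by simpa using hpR⟩
        have h2 : (n + ε * ‖p‖ ^ 2) / ε < ‖x‖ ^ 2 := by
          rw [← Real.sqrt_lt' (by linarith [norm_nonneg p])]
          linarith
        rw [div_lt_iff₀ hε] at h2
        have h3 := hS.normalSq_self_le hM hA hx
        linarith [hnn p]
    refine ⟨q, hq.1, ?_, fun x hx => (hmax x hx).trans (by nlinarith [sq_nonneg ‖q‖])⟩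
    -- The left side is nonnegative because |A|² < 1, which forces |q|² ≤ n independently of ε.
    obtain ⟨U, ν, hν, hqU, hle⟩ := hS.normalSq_mul_le hM hq.1 hmax
    have h1 := hA U ν hν q ⟨hq.1, hqU⟩
    have h2 : 0 ≤ ε * (n - ‖q‖ ^ 2) := (mul_nonneg (hnn q) (by linarith)).trans hle
    have := nonneg_of_mul_nonneg_right h2 hε
    linarith
  have hK : IsCompact (M ∩ Metric.closedBall 0 √n) :=
    (isCompact_closedBall (0 : Ambient n) _).inter_left hcl
  have hmem {q : Ambient n} (hq : q ∈ M) (hqn : ‖q‖ ^ 2 ≤ n) : q ∈ M ∩ Metric.closedBall 0 √n :=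
    ⟨hq, by simpa using Real.le_sqrt_of_sq_le hqn⟩
  obtain ⟨q₁, hq₁, hq₁n, -⟩ := hε one_pos
  obtain ⟨q, hq, hqmax⟩ := hK.exists_isMaxOn ⟨q₁, hmem hq₁ hq₁n⟩ (hcont.mono inter_subset_left)
  have hmax : ∀ x ∈ M, normalSq M x x ≤ normalSq M q q := by
    intro x hx
    have h1 : ∀ ε : ℝ, 0 < ε → normalSq M x x ≤ normalSq M q q + ε * ‖x‖ ^ 2 := fun ε hε0 => by
      obtain ⟨y, hy, hyn, hymax⟩ := hε hε0
      have h2 : normalSq M y y ≤ normalSq M q q := hqmax (hmem hy hyn)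
      linarith [hymax x hx]
    have h2 : Tendsto (fun ε : ℝ => normalSq M q q + ε * ‖x‖ ^ 2) (𝓝[>] 0)
        (𝓝 (normalSq M q q + 0 * ‖x‖ ^ 2)) :=
      tendsto_nhdsWithin_of_tendsto_nhds (Continuous.tendsto (by fun_prop) 0)
    rw [zero_mul, add_zero] at h2
    exact ge_of_tendsto h2 (by filter_upwards [self_mem_nhdsWithin] with ε hε using h1 ε hε)
  -- With ε = 0 the inequality reads H²(1 − |A|²) ≤ 0 at the global maximum of H².
  obtain ⟨U, ν, hν, hqU, hle⟩ := hS.normalSq_mul_le hM hq.1 (ε := 0)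
    (fun x hx => by simpa using hmax x hx)
  rw [zero_mul] at hle
  have h1 := hA U ν hν q ⟨hq.1, hqU⟩
  have h2 : normalSq M q q ≤ 0 := nonpos_of_mul_nonpos_left hle (by linarith)
  exact le_antisymm ((hmax p hp).trans h2) (hnn p)

/-- A closed hypersurface whose position vector is tangent is a hyperplane. -/
theorem IsSmoothHypersurface.isHyperplane_of_normalSq_self_eq_zero (hM : IsSmoothHypersurface M)
    (hcl : IsClosed M) (hne : M.Nonempty) (h0 : ∀ p ∈ M, normalSq M p p = 0) :
    IsHyperplane M := by
  have hloc : ∀ q ∈ M, ∀ᶠ s : ℝ in 𝓝 1, s • q ∈ M := by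
    intro q hq
    obtain ⟨e, g, δ, η, h, -⟩ := hM.exists_isLocalGraph_normal hq
    -- Tangency of the position vector is Euler's relation for `g`, so g(sq)/s is constant in s and
    -- small dilations of `q` remain on the graph.
    have hg : ∀ x ∈ solidCylinder q e δ, fderiv ℝ g x x = g x := by
      intro x hx
      have hqx : graphProj e g x ∈ M ∩ graphBox q e δ η :=
        ⟨h.graphProj_mem hx, h.graphProj_mem_graphBox hx⟩
      have h1 := h0 _ hqx.1
      rw [h.normalSq_eq hqx, sq_eq_zero_iff, h.inner_graphNormal_eq_zero_iff hqx.2.1,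
        h.inner_graphProj] at h1
      rw [← h1, graphProj, h.fderiv_add_smul, map_add, map_smul, h.fderiv_apply_direction hx,
        smul_zero, add_zero]
    have hc : ContinuousAt (fun s : ℝ => s • q) 1 := by fun_prop
    have hB : ∀ᶠ s : ℝ in 𝓝 1, s • q ∈ graphBox q e δ η :=
      hc.eventually (by simpa using (isOpen_graphBox q e δ η).mem_nhds h.center_mem_graphBox)
    obtain ⟨ρ, hρ, hρs⟩ := Metric.eventually_nhds_iff_ball.1
      (hB.and (eventually_gt_nhds (zero_lt_one (α := ℝ))))
    have hderiv : ∀ s ∈ Metric.ball (1 : ℝ) ρ,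
        HasDerivAt (fun s : ℝ => s⁻¹ * g (s • q)) 0 s := by
      intro s hs
      obtain ⟨hsB, hs0⟩ := hρs s hs
      have h1 : HasDerivAt (fun s : ℝ => s • q) q s := by
        simpa using (hasDerivAt_id s).smul_const q
      have h2 := (hasDerivAt_inv hs0.ne').mul
        ((h.differentiableAt hsB.1).hasFDerivAt.comp_hasDerivAt s h1)
      have h3 := hg _ hsB.1
      rw [map_smul, smul_eq_mul] at h3
      have h4 : -(s ^ 2)⁻¹ * g (s • q) + s⁻¹ * fderiv ℝ g (s • q) q = 0 := by
        rw [← h3]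
        field_simp
        ring
      exact h4 ▸ h2
    filter_upwards [Metric.ball_mem_nhds (1 : ℝ) hρ] with s hs
    obtain ⟨hsB, hs0⟩ := hρs s hs
    rw [h.mem_iff _ hsB.1 hsB.2]
    have h1 : (fun s : ℝ => s⁻¹ * g (s • q)) s = (fun s : ℝ => s⁻¹ * g (s • q)) 1 :=
      (convex_ball (1 : ℝ) ρ).is_const_of_fderivWithin_eq_zero (𝕜 := ℝ)
        (fun t ht => (hderiv t ht).differentiableAt.differentiableWithinAt)
        (fun t ht => by
          rw [fderivWithin_of_isOpen Metric.isOpen_ball ht]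
          ext
          simp [(hderiv t ht).deriv]) hs (Metric.mem_ball_self hρ)
    simp only [inv_one, one_mul, one_smul, h.apply_center] at h1
    rw [inner_smul_right, ← h1]
    field_simp
  -- The set of admissible dilation factors is open by `hloc`, closed because M is, and nonempty,
  -- hence all of (0, ∞).
  have hray : ∀ p ∈ M, ∀ s : ℝ, 0 < s → s • p ∈ M := by
    intro p hp
    have hcl' : IsClosed {s : Ioi (0 : ℝ) | (s : ℝ) • p ∈ M} :=
      hcl.preimage (by fun_prop)
    have hop : IsOpen {s : Ioi (0 : ℝ) | (s : ℝ) • p ∈ M} := by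
      rw [isOpen_iff_mem_nhds]
      intro s hs
      have hs0 : (0 : ℝ) < s := s.2
      have h1 : ContinuousAt (fun t : Ioi (0 : ℝ) => (t : ℝ) / s) s := by fun_prop
      have h2 := h1.eventually (p := fun t => t • (s : ℝ) • p ∈ M)
        (by simpa only [div_self hs0.ne'] using hloc _ hs)
      filter_upwards [h2] with t ht
      rw [smul_smul, div_mul_cancel₀ _ hs0.ne'] at ht
      exact ht
    have : PreconnectedSpace (Ioi (0 : ℝ)) := Subtype.preconnectedSpace isPreconnected_Ioi
    have huniv := IsClopen.eq_univ ⟨hcl', hop⟩ ⟨⟨1, mem_Ioi.2 one_pos⟩, by simpa using hp⟩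
    exact fun s hs => (huniv.ge (mem_univ (⟨s, hs⟩ : Ioi (0 : ℝ))) :)
  have hzero : (0 : Ambient n) ∈ M := by
    obtain ⟨p, hp⟩ := hne
    have h1 : Tendsto (fun s : ℝ => s • p) (𝓝[>] 0) (𝓝 ((0 : ℝ) • p)) :=
      tendsto_nhdsWithin_of_tendsto_nhds (Continuous.tendsto (by fun_prop) 0)
    rw [zero_smul] at h1
    exact hcl.mem_of_tendsto h1
      (by filter_upwards [self_mem_nhdsWithin] with s hs using hray p hp s hs)
  obtain ⟨e, g, δ, η, h, hc⟩ := hM.exists_isLocalGraph_normal hzero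
  have hev (x : Ambient n) : ∀ᶠ s : ℝ in 𝓝[>] 0, s • x ∈ graphBox 0 e δ η := by
    have h1 : Tendsto (fun s : ℝ => s • x) (𝓝[>] 0) (𝓝 ((0 : ℝ) • x)) :=
      tendsto_nhdsWithin_of_tendsto_nhds (Continuous.tendsto (by fun_prop) 0)
    exact h1.eventually (by simpa using (isOpen_graphBox 0 e δ η).mem_nhds h.center_mem_graphBox)
  -- The ray through `x` lies in M and ends at 0, so its direction is tangent at 0. Only positive
  -- dilations are available, hence the comparison of one-sided derivatives.
  have hsub : ∀ x ∈ M, ⟪e, x⟫_ℝ = 0 := by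
    intro x hx
    have h1 : x ∈ tangentSubspace M 0 := by
      rw [h.mem_tangentSubspace_iff ⟨hzero, h.center_mem_graphBox⟩,
        h.inner_graphNormal_eq_zero_iff h.center_mem_solidCylinder]
      have h2 : HasDerivAt (fun s : ℝ => s • x) x 0 := by
        simpa using (hasDerivAt_id (0 : ℝ)).smul_const x
      have h3 : HasFDerivAt g (fderiv ℝ g 0) ((0 : ℝ) • x) := by
        simpa using (h.differentiableAt h.center_mem_solidCylinder).hasFDerivAt
      have h4 : HasDerivAt (fun s : ℝ => ⟪e, s • x⟫_ℝ) ⟪e, x⟫_ℝ 0 := by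
        simpa using (hasDerivAt_const (0 : ℝ) e).inner ℝ h2
      refine (uniqueDiffWithinAt_Ioi (0 : ℝ)).eq_deriv _
        (h3.comp_hasDerivAt 0 h2).hasDerivWithinAt (h4.hasDerivWithinAt.congr_of_eventuallyEq ?_ ?_)
      · filter_upwards [hev x, self_mem_nhdsWithin] with s hs hs0
        exact ((h.mem_iff _ hs.1 hs.2).1 (hray x hx s hs0)).symm
      · simp [h.apply_center]
    have h2 := (h.mem_tangentSubspace_iff ⟨hzero, h.center_mem_graphBox⟩ x).1 h1
    rwa [hc] at h2
  refine ⟨e, 0, norm_ne_zero_iff.1 (by rw [h.norm_eq_one]; norm_num), Subset.antisymm hsub ?_⟩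
  intro x hx
  have hx' : ⟪e, x⟫_ℝ = 0 := hx
  obtain ⟨s, hs, hs0⟩ := ((hev x).and self_mem_nhdsWithin).exists
  -- The point of M over the small multiple `s • x` lies in the hyperplane by `hsub`, so the graph
  -- has height 0 there and `s • x` itself is in M.
  have h1 := hsub _ (h.graphProj_mem hs.1)
  rw [h.inner_graphProj] at h1
  have h2 : s • x ∈ M := by rw [h.mem_iff _ hs.1 hs.2, h1, inner_smul_right, hx', mul_zero]
  have h3 := hray _ h2 s⁻¹ (inv_pos.2 hs0)
  rwa [inv_smul_smul₀ (ne_of_gt hs0)] at h3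

end SelfShrinker

/-! ### The intrinsic distance -/

section Intrinsic

variable {n : ℕ} {M : Set (Ambient n)}

theorem edist_le_intrinsicEDist (M : Set (Ambient n)) (p q : Ambient n) :
    edist p q ≤ intrinsicEDist M p q := by
  refine le_iInf fun γ => le_iInf fun _ => le_iInf fun _ => le_iInf fun h0 => le_iInf fun h1 => ?_
  rw [← h0, ← h1]
  exact eVariationOn.edist_le γ (by simp) (by simp)

theorem intrinsicEDist_le_eVariationOn {γ : ℝ → Ambient n} (hc : ContinuousOn γ (Icc 0 1))
    (hM : MapsTo γ (Icc 0 1) M) : intrinsicEDist M (γ 0) (γ 1) ≤ eVariationOn γ (Icc 0 1) :=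
  iInf_le_of_le γ (iInf_le_of_le hc (iInf_le_of_le hM (iInf_le_of_le rfl (iInf_le _ rfl))))

theorem exists_path_of_intrinsicEDist_lt {p q : Ambient n} {ε : ℝ≥0∞}
    (h : intrinsicEDist M p q < ε) : ∃ γ : ℝ → Ambient n, ContinuousOn γ (Icc 0 1) ∧
      MapsTo γ (Icc 0 1) M ∧ γ 0 = p ∧ γ 1 = q ∧ eVariationOn γ (Icc 0 1) < ε := by
  simp only [intrinsicEDist, iInf_lt_iff] at h
  obtain ⟨γ, h1, h2, h3, h4, h5⟩ := h
  exact ⟨γ, h1, h2, h3, h4, h5⟩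

theorem intrinsicEDist_le_of_lipschitzOnWith {γ : ℝ → Ambient n} {K : ℝ≥0}
    (hγ : LipschitzOnWith K γ (Icc 0 1)) (hM : MapsTo γ (Icc 0 1) M) :
    intrinsicEDist M (γ 0) (γ 1) ≤ K := by
  refine (intrinsicEDist_le_eVariationOn hγ.continuousOn hM).trans ?_
  have h1 := hγ.comp_eVariationOn_le (g := id) (s := Icc (0 : ℝ) 1) (mapsTo_id _)
  have h2 : eVariationOn (id : ℝ → ℝ) (Icc 0 1) ≤ 1 := by
    have := (monotone_id (α := ℝ)).monotoneOn (Icc 0 1) |>.eVariationOn_eq (a := 0) (b := 1)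
      (by simp) (by simp)
    rw [inter_self] at this
    rw [this]
    simp
  refine h1.trans ?_
  calc (K : ℝ≥0∞) * eVariationOn (id : ℝ → ℝ) (Icc 0 1) ≤ K * 1 := by gcongr
    _ = K := mul_one _

theorem intrinsicEDist_self {p : Ambient n} (hp : p ∈ M) : intrinsicEDist M p p = 0 := by
  have := intrinsicEDist_le_of_lipschitzOnWith (M := M) (γ := fun _ => p) (K := 0)
    (LipschitzWith.const p).lipschitzOnWith (fun _ _ => hp)
  simpa using this

theorem intrinsicEDist_comm_le (M : Set (Ambient n)) (p q : Ambient n) :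
    intrinsicEDist M q p ≤ intrinsicEDist M p q := by
  refine le_of_forall_gt fun ε hε => ?_
  obtain ⟨γ, h1, h2, rfl, rfl, h5⟩ := exists_path_of_intrinsicEDist_lt hε
  have hmaps : MapsTo (fun t : ℝ => 1 - t) (Icc 0 1) (Icc 0 1) := fun t ht =>
    ⟨by linarith [ht.2], by linarith [ht.1]⟩
  have h6 := intrinsicEDist_le_eVariationOn (M := M) (γ := γ ∘ fun t => 1 - t)
    (h1.comp (by fun_prop) hmaps) (h2.comp hmaps)
  simp only [Function.comp_apply, sub_zero, sub_self] at h6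
  refine (h6.trans ?_).trans_lt h5
  exact eVariationOn.comp_le_of_antitoneOn γ _ (fun a _ b _ hab => sub_le_sub_left hab 1) hmaps

theorem intrinsicEDist_comm (M : Set (Ambient n)) (p q : Ambient n) :
    intrinsicEDist M p q = intrinsicEDist M q p :=
  le_antisymm (intrinsicEDist_comm_le M q p) (intrinsicEDist_comm_le M p q)

theorem intrinsicEDist_triangle (M : Set (Ambient n)) (p q r : Ambient n) :
    intrinsicEDist M p r ≤ intrinsicEDist M p q + intrinsicEDist M q r := by
  refine ENNReal.le_of_forall_pos_le_add fun ε hε hlt => ?_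
  have hε2 : ((ε / 2 : ℝ≥0) : ℝ≥0∞) ≠ 0 := by simpa using hε.ne'
  have hε₁ := ENNReal.lt_add_right (ENNReal.add_lt_top.1 hlt).1.ne hε2
  have hε₂ := ENNReal.lt_add_right (ENNReal.add_lt_top.1 hlt).2.ne hε2
  obtain ⟨γ, h1, h2, h3, h4, h5⟩ := exists_path_of_intrinsicEDist_lt hε₁
  obtain ⟨γ', h1', h2', h3', h4', h5'⟩ := exists_path_of_intrinsicEDist_lt hε₂
  set c : ℝ → Ambient n := fun t => if t ≤ 1 / 2 then γ (2 * t) else γ' (2 * t - 1) with hc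
  have hm1 : MapsTo (fun t : ℝ => 2 * t) (Icc 0 (1 / 2)) (Icc 0 1) := fun t ht =>
    ⟨by linarith [ht.1], by linarith [ht.2]⟩
  have hm2 : MapsTo (fun t : ℝ => 2 * t - 1) (Icc (1 / 2) 1) (Icc 0 1) := fun t ht =>
    ⟨by linarith [ht.1], by linarith [ht.2]⟩
  have hc1 : EqOn c (γ ∘ fun t => 2 * t) (Icc 0 (1 / 2)) := fun t ht => by
    simp only [hc, if_pos ht.2, Function.comp_apply]
  have hc2 : EqOn c (γ' ∘ fun t => 2 * t - 1) (Icc (1 / 2) 1) := fun t ht => by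
    rcases ht.1.eq_or_lt with h | h
    · simp [hc, ← h, h3', h4]
    · simp only [hc, if_neg (not_le.2 h), Function.comp_apply]
  have hU : Icc (0 : ℝ) 1 = Icc 0 (1 / 2) ∪ Icc (1 / 2) 1 :=
    (Icc_union_Icc_eq_Icc (by norm_num) (by norm_num)).symm
  have hcont : ContinuousOn c (Icc 0 1) := by
    rw [hU]
    refine ContinuousOn.union_of_isClosed ?_ ?_ isClosed_Icc isClosed_Icc
    · exact (h1.comp (by fun_prop) hm1).congr hc1
    · exact (h1'.comp (by fun_prop) hm2).congr hc2
  have hmaps : MapsTo c (Icc 0 1) M := by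
    rw [hU]
    refine MapsTo.union ?_ ?_
    · exact (h2.comp hm1).congr hc1.symm
    · exact (h2'.comp hm2).congr hc2.symm
  have h6 := intrinsicEDist_le_eVariationOn hcont hmaps
  have h7 : eVariationOn c (Icc 0 1) ≤ eVariationOn γ (Icc 0 1) + eVariationOn γ' (Icc 0 1) := by
    conv_lhs => rw [hU]
    rw [eVariationOn.union c (isGreatest_Icc (by norm_num)) (isLeast_Icc (by norm_num)),
      eVariationOn.congr hc1, eVariationOn.congr hc2]
    gcongr
    · exact eVariationOn.comp_le_of_monotoneOn γ _
        (fun a _ b _ hab => mul_le_mul_of_nonneg_left hab zero_le_two) hm1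
    · exact eVariationOn.comp_le_of_monotoneOn γ' _
        (fun a _ b _ hab => sub_le_sub_right (mul_le_mul_of_nonneg_left hab zero_le_two) 1) hm2
  rw [hc1 (by simp), hc2 (by norm_num)] at h6
  norm_num [h3, h4'] at h6
  refine ((h6.trans h7).trans_lt (ENNReal.add_lt_add h5 h5')).le.trans_eq ?_
  rw [add_add_add_comm, ← ENNReal.coe_add, add_halves]

/-- Segments from `p` lift to the local graph by the Lipschitz map `graphProj`, which bounds the
intrinsic distance by a multiple of the Euclidean one near `p`. -/
theorem IsSmoothHypersurface.tendsto_intrinsicEDist (hM : IsSmoothHypersurface M)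
    {p : Ambient n} (hp : p ∈ M) : Tendsto (intrinsicEDist M p) (𝓝[M] p) (𝓝 0) := by
  obtain ⟨e, g, δ, η, h, -⟩ := hM.exists_isLocalGraph_normal hp
  have hs : ContDiffAt ℝ 1 (graphProj e g) p :=
    ((contDiffOn_id.add ((h.contDiffOn.sub (innerSL ℝ e).contDiff.contDiffOn).smul
      contDiffOn_const)).contDiffAt ((isOpen_solidCylinder p e δ).mem_nhds
        h.center_mem_solidCylinder)).of_le (by simp)
  obtain ⟨K, s, hs, hK⟩ := hs.exists_lipschitzOnWith
  obtain ⟨ρ, hρ, hρs⟩ := Metric.mem_nhds_iff.1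
    (inter_mem hs ((isOpen_graphBox p e δ η).mem_nhds h.center_mem_graphBox))
  have hbound : ∀ᶠ x in 𝓝[M] p, intrinsicEDist M p x ≤ (K : ℝ≥0∞) * edist x p := by
    filter_upwards [self_mem_nhdsWithin, mem_nhdsWithin_of_mem_nhds (Metric.ball_mem_nhds p hρ)]
      with x hxM hx
    have hmaps : MapsTo (fun t : ℝ => AffineMap.lineMap p x t) (Icc 0 1) (Metric.ball p ρ) :=
      fun t ht => (convex_ball p ρ).lineMap_mem (Metric.mem_ball_self hρ) hx ht
    have hl : LipschitzOnWith (K * nndist x p)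
        (graphProj e g ∘ fun t : ℝ => AffineMap.lineMap p x t) (Icc 0 1) :=
      (hK.mono (hρs.trans inter_subset_left)).comp
        (LipschitzWith.lipschitzOnWith (by
          have := lipschitzWith_lineMap (𝕜 := ℝ) p x
          rwa [nndist_comm] at this)) hmaps
    have h1 := intrinsicEDist_le_of_lipschitzOnWith hl
      (fun t ht => h.graphProj_mem (hρs (hmaps ht)).2.1)
    simp only [Function.comp_apply, AffineMap.lineMap_apply_zero, AffineMap.lineMap_apply_one,
      h.graphProj_center] at h1
    rw [h.graphProj_eq_self ⟨hxM, (hρs hx).2⟩] at h1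
    rwa [ENNReal.coe_mul, ← edist_nndist] at h1
  have hlim : Tendsto (fun x => (K : ℝ≥0∞) * edist x p) (𝓝[M] p) (𝓝 0) := by
    have : Tendsto (fun x => edist x p) (𝓝[M] p) (𝓝 (edist p p)) :=
      tendsto_nhdsWithin_of_tendsto_nhds (Continuous.tendsto (by fun_prop) p)
    rw [edist_self] at this
    simpa using ENNReal.Tendsto.const_mul this (Or.inr ENNReal.coe_ne_top)
  exact tendsto_of_tendsto_of_tendsto_of_le_of_le' tendsto_const_nhds hlim
    (.of_forall fun _ => zero_le) hbound

/-- A closed hypersurface is complete for its intrinsic distance. -/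
theorem IsSmoothHypersurface.isIntrinsicallyComplete (hM : IsSmoothHypersurface M)
    (hcl : IsClosed M) : IsIntrinsicallyComplete M := by
  intro u hu hC
  have hcau : CauchySeq u := EMetric.cauchySeq_iff.2 fun ε hε => by
    obtain ⟨N, hN⟩ := hC ε hε
    exact ⟨N, fun k hk l hl => (edist_le_intrinsicEDist M _ _).trans_lt (hN k hk l hl)⟩
  obtain ⟨p, hp⟩ := cauchySeq_tendsto_of_complete hcau
  have hpM : p ∈ M := hcl.mem_of_tendsto hp (.of_forall hu)
  refine ⟨p, hpM, ?_⟩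
  simp only [intrinsicEDist_comm M _ p]
  exact (hM.tendsto_intrinsicEDist hpM).comp
    (tendsto_nhdsWithin_iff.2 ⟨hp, .of_forall hu⟩)

/-- The points of `M`, with the intrinsic distance. -/
structure IntrinsicSpace (M : Set (Ambient n)) where
  /-- The underlying point of Euclidean space. -/
  val : Ambient n
  val_mem : val ∈ M

noncomputable instance : PseudoEMetricSpace (IntrinsicSpace M) where
  edist x y := intrinsicEDist M x.val y.val
  edist_self x := intrinsicEDist_self x.val_mem
  edist_comm x y := intrinsicEDist_comm M _ _
  edist_triangle x y z := intrinsicEDist_triangle M _ _ _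

theorem IntrinsicSpace.continuous_val : Continuous (IntrinsicSpace.val (M := M)) :=
  (LipschitzWith.of_edist_le fun _ _ => edist_le_intrinsicEDist M _ _).continuous

/-- The intrinsic topology is the subspace topology, since each distance controls the other near a
point. Consequently intrinsic balls are traces of ambient open sets, which makes them accessible to
Borel measures. -/
theorem IsSmoothHypersurface.isInducing_val (hM : IsSmoothHypersurface M) :
    IsInducing (IntrinsicSpace.val (M := M)) := by
  refine isInducing_iff_nhds.2 fun x => le_antisymm
    (IntrinsicSpace.continuous_val.tendsto x).le_comap ?_
  refine Metric.nhds_basis_eball.ge_iff.2 fun ε hε => ?_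
  have h1 : ∀ᶠ y in 𝓝 x.val, y ∈ M → intrinsicEDist M x.val y < ε :=
    eventually_nhdsWithin_iff.1
      ((hM.tendsto_intrinsicEDist x.val_mem).eventually (gt_mem_nhds hε))
  refine mem_comap.2 ⟨_, h1, fun y hy => ?_⟩
  rw [Metric.mem_eball, edist_comm]
  exact hy y.val_mem

theorem IsIntrinsicallyComplete.completeSpace (hC : IsIntrinsicallyComplete M) :
    CompleteSpace (IntrinsicSpace M) := by
  refine EMetric.complete_of_cauchySeq_tendsto fun u hu => ?_
  obtain ⟨p, hp, hlim⟩ := hC (fun k => (u k).val) (fun k => (u k).val_mem)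
    (fun ε hε => EMetric.cauchySeq_iff.1 hu ε hε)
  exact ⟨⟨p, hp⟩, tendsto_iff_edist_tendsto_0.2 hlim⟩

end Intrinsic

/-! ### Graphs of uniform size from |A| < 1 and completeness -/

section Lifting

variable {n : ℕ} {M : Set (Ambient n)}

theorem IsSmoothHypersurface.continuousOn_normalSq (hM : IsSmoothHypersurface M) (e : Ambient n) :
    ContinuousOn (fun p => normalSq M p e) M := by
  intro p hp
  obtain ⟨e', g, δ, η, h, -⟩ := hM.exists_isLocalGraph_normal hp
  have h1 : ContinuousAt (fun x => ⟪graphNormal e' g x, e⟫_ℝ ^ 2) p :=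
    (((h.contDiffOn_graphNormal.continuousOn).continuousAt ((isOpen_solidCylinder p e' δ).mem_nhds
      h.center_mem_solidCylinder)).inner continuousAt_const).pow 2
  refine h1.continuousWithinAt.congr_of_eventuallyEq ?_ ?_
  · filter_upwards [self_mem_nhdsWithin, mem_nhdsWithin_of_mem_nhds
      ((isOpen_graphBox p e' δ η).mem_nhds h.center_mem_graphBox)] with x hx hx'
    exact h.normalSq_eq ⟨hx, hx'⟩ e
  · exact h.normalSq_eq ⟨hp, h.center_mem_graphBox⟩ e

/-- The squared cosine of the angle between the normal and `e` is 1/(1 + |∇g|²). Slope below one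
thus means that it exceeds 1/2, the threshold used in the lifting. -/
theorem IsLocalGraph.inner_graphNormal_direction_sq {p e x : Ambient n} {g : Ambient n → ℝ}
    {δ η : ℝ} (h : IsLocalGraph M p e g δ η) (hx : x ∈ solidCylinder p e δ) :
    ⟪graphNormal e g x, e⟫_ℝ ^ 2 * (1 + ‖gradient g x‖ ^ 2) = 1 := by
  have h1 : ‖e - gradient g x‖ ^ 2 = 1 + ‖gradient g x‖ ^ 2 := by
    rw [norm_sub_sq_real, h.inner_gradient_direction hx, h.norm_eq_one]
    ring
  rw [graphNormal, inner_smul_left, real_inner_comm, h.inner_sub_gradient hx, ← h1]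
  have := (h.norm_sub_gradient_pos hx).ne'
  simp
  field_simp

/-- Where the graph has slope at most one, lifts of lines have at most twice their speed. -/
theorem IsLocalGraph.norm_dirDeriv_graphProj_le {p e x v : Ambient n} {g : Ambient n → ℝ}
    {δ η : ℝ} (h : IsLocalGraph M p e g δ η) (hx : x ∈ solidCylinder p e δ)
    (hw : 1 / 2 < ⟪graphNormal e g x, e⟫_ℝ ^ 2) (hv : ⟪e, v⟫_ℝ = 0) :
    ‖dirDeriv v (graphProj e g) x‖ ≤ 2 * ‖v‖ := by
  have h1 := h.inner_graphNormal_direction_sq hx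
  have h2 : ‖gradient g x‖ ≤ 1 := by
    by_contra! h3
    nlinarith
  rw [h.dirDeriv_graphProj hx, hv, sub_zero]
  refine (norm_add_le _ _).trans ?_
  rw [norm_smul, h.norm_eq_one, mul_one, ← inner_gradient]
  have h3 : ‖⟪gradient g x, v⟫_ℝ‖ ≤ ‖gradient g x‖ * ‖v‖ := norm_inner_le_norm _ _
  nlinarith [norm_nonneg v]

/-- A hypersurface with `|A| < 1` can be lifted over a short piece of a line. -/
theorem IsSmoothHypersurface.exists_lift_step (hM : IsSmoothHypersurface M)
    (hA : ∀ U ν, IsUnitNormalField M U ν → ∀ p ∈ M ∩ U, normSqSecondFundamentalForm M ν p < 1)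
    {p e v : Ambient n} (hp : p ∈ M) (he : ‖e‖ = 1) (hv : ⟪e, v⟫_ℝ = 0)
    (hw : 1 / 2 < normalSq M p e) :
    ∃ s₀ > 0, ∀ s : ℝ, 0 < s → s ≤ s₀ → ∃ q ∈ M, orthPart e (q - p) = s • v ∧
      intrinsicEDist M p q ≤ ENNReal.ofReal (2 * ‖v‖ * s) ∧
      normalSq M p e - 4 * ‖v‖ * s ≤ normalSq M q e := by
  have heT : e ∉ tangentSubspace M p := by
    obtain ⟨e', he', hT⟩ := hM.exists_unit_normal hp
    rw [normalSq_eq he' hT] at hw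
    rw [hT]
    intro h0
    rw [h0] at hw
    norm_num at hw
  obtain ⟨g, δ, η, h⟩ := hM.exists_isLocalGraph hp he heT
  have hD := isOpen_solidCylinder p e δ
  set ν := graphNormal e g with hν
  have hline (t : ℝ) : HasDerivAt (fun t : ℝ => p + t • v) v t := by
    simpa using ((hasDerivAt_id t).smul_const v).const_add p
  have hev : ∀ᶠ x in 𝓝 p, x ∈ solidCylinder p e δ ∧ 1 / 2 < ⟪ν x, e⟫_ℝ ^ 2 := by
    refine (hD.eventually_mem h.center_mem_solidCylinder).and ?_
    have h1 : ContinuousAt (fun x => ⟪ν x, e⟫_ℝ ^ 2) p :=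
      (((h.contDiffOn_graphNormal.continuousOn).continuousAt (hD.mem_nhds
        h.center_mem_solidCylinder)).inner continuousAt_const).pow 2
    rw [h.normalSq_eq ⟨hp, h.center_mem_graphBox⟩] at hw
    exact h1.eventually (lt_mem_nhds hw)
  have hlim : Tendsto (fun t : ℝ => p + t • v) (𝓝 0) (𝓝 p) := by
    simpa using (hline 0).continuousAt.tendsto
  obtain ⟨ρ, hρ, hρs⟩ := Metric.eventually_nhds_iff_ball.1 (hlim.eventually hev)
  refine ⟨ρ / 2, by linarith, fun s hs hsρ => ?_⟩
  have hmem {t : ℝ} (ht : t ∈ Icc 0 s) := hρs t (by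
    rw [Metric.mem_ball, Real.dist_eq, sub_zero, abs_of_nonneg ht.1]; linarith [ht.2])
  set c : ℝ → Ambient n := fun t => graphProj e g (p + t • v) with hc
  have hcd {t : ℝ} (ht : t ∈ Icc 0 s) :
      HasDerivAt c (dirDeriv v (graphProj e g) (p + t • v)) t := by
    have h1 := (h.hasFDerivAt_graphProj (hmem ht).1).differentiableAt.hasFDerivAt
    exact h1.comp_hasDerivAt t (hline t)
  have hcM {t : ℝ} (ht : t ∈ Icc 0 s) : c t ∈ M ∩ graphBox p e δ η :=
    ⟨h.graphProj_mem (hmem ht).1, h.graphProj_mem_graphBox (hmem ht).1⟩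
  have hc0 : c 0 = p := by simp [hc, h.graphProj_center]
  have hlip : LipschitzOnWith (2 * ‖v‖₊) c (Icc 0 s) :=
    (convex_Icc 0 s).lipschitzOnWith_of_nnnorm_hasDerivWithin_le
      (fun t ht => (hcd ht).hasDerivWithinAt) fun t ht => by
        have := h.norm_dirDeriv_graphProj_le (hmem ht).1 (hmem ht).2 hv
        exact_mod_cast this
  have hs' : s ∈ Icc 0 s := ⟨hs.le, le_rfl⟩
  refine ⟨c s, (hcM hs').1, ?_, ?_, ?_⟩
  · simp only [hc, graphProj]
    rw [add_sub_right_comm, add_sub_cancel_left, map_add, map_smul, map_smul, orthPart_self he,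
      smul_zero, add_zero, orthPart_of_inner_eq_zero hv]
  · have hmaps : MapsTo (fun t : ℝ => s * t) (Icc 0 1) (Icc 0 s) := fun t ht =>
      ⟨mul_nonneg hs.le ht.1, by nlinarith [ht.2]⟩
    have hl2 : LipschitzOnWith (2 * ‖v‖₊ * s.toNNReal) (c ∘ fun t => s * t) (Icc 0 1) := by
      refine hlip.comp (LipschitzWith.lipschitzOnWith ?_) hmaps
      refine LipschitzWith.of_dist_le_mul fun a b => ?_
      rw [Real.dist_eq, Real.dist_eq, ← mul_sub, abs_mul, abs_of_pos hs, Real.coe_toNNReal _ hs.le]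
    have h1 := intrinsicEDist_le_of_lipschitzOnWith (M := M) hl2 (fun t ht => (hcM (hmaps ht)).1)
    simp only [Function.comp_apply, mul_zero, mul_one, hc0] at h1
    refine h1.trans_eq ?_
    rw [ENNReal.ofReal_mul (by positivity), ENNReal.ofReal_mul (by positivity)]
    simp [ENNReal.ofReal]
  -- The tilt of the normal along the lift. The lift has speed at most 2‖v‖ and |A| < 1, so the
  -- normal turns at rate at most 2‖v‖ and the square `w` changes at rate at most 2 · 1 · 2‖v‖.
  · set w : ℝ → ℝ := fun t => ⟪ν (p + t • v), e⟫_ℝ ^ 2 with hwdef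
    have hwM {t : ℝ} (ht : t ∈ Icc 0 s) : normalSq M (c t) e = w t := by
      rw [h.normalSq_eq (hcM ht), hc, h.graphNormal_graphProj]
    have hwd {t : ℝ} (ht : t ∈ Icc 0 s) : HasDerivAt w
        (2 * ⟪ν (p + t • v), e⟫_ℝ * ⟪fderiv ℝ ν (p + t • v) v, e⟫_ℝ) t := by
      have h1 := (h.contDiffOn_graphNormal.differentiableAt_of_isOpen hD
        (hmem ht).1).hasFDerivAt.comp_hasDerivAt t (hline t)
      have h2 := (h1.inner ℝ (hasDerivAt_const t e)).pow 2
      have h3 : ((2 : ℕ) : ℝ) * ⟪ν (p + t • v), e⟫_ℝ ^ (2 - 1) *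
          (⟪ν (p + t • v), (0 : Ambient n)⟫_ℝ + ⟪fderiv ℝ ν (p + t • v) v, e⟫_ℝ) =
          2 * ⟪ν (p + t • v), e⟫_ℝ * ⟪fderiv ℝ ν (p + t • v) v, e⟫_ℝ := by simp
      exact h3 ▸ h2
    have hbound {t : ℝ} (ht : t ∈ Icc 0 s) :
        ‖2 * ⟪ν (p + t • v), e⟫_ℝ * ⟪fderiv ℝ ν (p + t • v) v, e⟫_ℝ‖ ≤ 4 * ‖v‖ := by
      have hx := (hmem ht).1
      have hu := h.dirDeriv_graphProj_mem_tangentSubspace hx v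
      have h1 := h.norm_sq_fderiv_graphNormal_le (hcM ht) hu
      rw [h.fderiv_graphNormal_graphProj] at h1
      have h2 : fderiv ℝ ν (p + t • v) (dirDeriv v (graphProj e g) (p + t • v)) =
          fderiv ℝ ν (p + t • v) v := by
        rw [h.dirDeriv_graphProj hx, map_add, map_smul, h.fderiv_graphNormal_direction hx,
          smul_zero, add_zero]
      rw [h2] at h1
      have h3 := h.norm_dirDeriv_graphProj_le hx (hmem ht).2 hv
      have h4 := hA _ _ h.isUnitNormalField _ (hcM ht)
      have h5 : ‖fderiv ℝ ν (p + t • v) v‖ ≤ 2 * ‖v‖ := by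
        refine abs_le_of_sq_le_sq' ?_ (by positivity) |>.2
        calc _ ≤ 1 * ‖dirDeriv v (graphProj e g) (p + t • v)‖ ^ 2 := h1.trans (by gcongr)
          _ ≤ (2 * ‖v‖) ^ 2 := by rw [one_mul]; gcongr
      have h6 : ‖⟪ν (p + t • v), e⟫_ℝ‖ ≤ 1 := by
        refine (norm_inner_le_norm _ _).trans_eq ?_
        rw [h.norm_graphNormal hx, he, one_mul]
      have h7 : ‖⟪fderiv ℝ ν (p + t • v) v, e⟫_ℝ‖ ≤ 2 * ‖v‖ := by
        refine (norm_inner_le_norm _ _).trans ?_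
        rwa [he, mul_one]
      rw [norm_mul, norm_mul, Real.norm_two]
      calc _ ≤ 2 * 1 * (2 * ‖v‖) := by gcongr
        _ = 4 * ‖v‖ := by ring
    have h1 := (convex_Icc 0 s).norm_image_sub_le_of_norm_hasDerivWithin_le
      (fun t ht => (hwd ht).hasDerivWithinAt) (fun t ht => hbound ht) ⟨le_rfl, hs.le⟩ hs'
    rw [sub_zero, Real.norm_eq_abs, Real.norm_eq_abs, abs_of_pos hs, abs_le] at h1
    have h2 := hwM ⟨le_rfl, hs.le⟩
    rw [hc0] at h2
    rw [h2, hwM hs']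
    linarith [h1.1]

/-- A complete hypersurface with `|A| < 1` contains, near each of its points, a graph over a ball
of fixed radius in the tangent space. -/
theorem IsSmoothHypersurface.exists_lift (hM : IsSmoothHypersurface M)
    (hC : IsIntrinsicallyComplete M)
    (hA : ∀ U ν, IsUnitNormalField M U ν → ∀ p ∈ M ∩ U, normSqSecondFundamentalForm M ν p < 1)
    {q e v : Ambient n} (hq : q ∈ M) (he : ‖e‖ = 1)
    (hT : ∀ v, v ∈ tangentSubspace M q ↔ ⟪e, v⟫_ℝ = 0) (hv : ⟪e, v⟫_ℝ = 0) (hv' : ‖v‖ ≤ 1 / 16) :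
    ∃ x ∈ M, orthPart e (x - q) = v ∧ intrinsicEDist M q x ≤ ENNReal.ofReal (2 * ‖v‖) := by
  -- Zorn's lemma on the endpoints of partial lifts of the segment from 0 to `v`. A pair is a time
  -- and a point over that time, with bounds on the tilt and on the distance from `q`; the relation
  -- `r` bounds the intrinsic distance between two endpoints by 2‖v‖ times the elapsed time.
  let X : Set (ℝ × Ambient n) := {a | 0 ≤ a.1 ∧ a.1 ≤ 1 ∧ a.2 ∈ M ∧
    orthPart e (a.2 - q) = a.1 • v ∧ 1 - 4 * ‖v‖ * a.1 ≤ normalSq M a.2 e ∧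
    intrinsicEDist M q a.2 ≤ ENNReal.ofReal (2 * ‖v‖ * a.1)}
  let r : X → X → Prop := fun a b => a.1.1 ≤ b.1.1 ∧
    intrinsicEDist M a.1.2 b.1.2 ≤ ENNReal.ofReal (2 * ‖v‖ * (b.1.1 - a.1.1))
  have hq0 : ((0 : ℝ), q) ∈ X := by
    refine ⟨le_rfl, zero_le_one, hq, by simp, ?_, by simp [intrinsicEDist_self hq]⟩
    rw [normalSq_eq he hT, real_inner_self_eq_norm_sq, he]
    simp
  have htrans : ∀ {a b c : X}, r a b → r b c → r a c := by
    rintro a b c ⟨h1, h2⟩ ⟨h3, h4⟩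
    refine ⟨h1.trans h3, (intrinsicEDist_triangle M _ b.1.2 _).trans ((add_le_add h2 h4).trans ?_)⟩
    rw [← ENNReal.ofReal_add (mul_nonneg (by positivity) (by linarith))
      (mul_nonneg (by positivity) (by linarith))]
    exact ENNReal.ofReal_le_ofReal (by linarith)
  have hchain : ∀ c : Set X, IsChain r c → ∃ ub, ∀ a ∈ c, r a ub := by
    intro c hc
    rcases c.eq_empty_or_nonempty with rfl | hne
    · exact ⟨⟨_, hq0⟩, by simp⟩
    have hrefl (a : X) : r a a := ⟨le_rfl, by simp [intrinsicEDist_self a.2.2.2.1]⟩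
    set S : Set ℝ := (fun a : X => a.1.1) '' c with hS
    have hSb : BddAbove S := ⟨1, by rintro _ ⟨a, -, rfl⟩; exact a.2.2.1⟩
    have hSne : S.Nonempty := hne.image _
    have hle {a : X} (ha : a ∈ c) : a.1.1 ≤ sSup S := le_csSup hSb ⟨a, ha, rfl⟩
    -- If the supremal time is attained, that element is an upper bound: comparable elements with
    -- equal times are at intrinsic distance 0.
    by_cases hatt : ∃ a ∈ c, a.1.1 = sSup S
    · obtain ⟨a, ha, haS⟩ := hatt
      refine ⟨a, fun b hb => ?_⟩
      rcases eq_or_ne b a with rfl | hba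
      · exact hrefl b
      rcases hc hb ha hba with h1 | h1
      · exact h1
      · have h2 : b.1.1 = a.1.1 := le_antisymm (haS ▸ hle hb) h1.1
        refine ⟨h2.le, ?_⟩
        rw [intrinsicEDist_comm]
        simpa [h2] using h1.2
    push Not at hatt
    obtain ⟨t, htm, htlim, htS⟩ := exists_seq_tendsto_sSup hSne hSb
    choose a hac hat using htS
    have hcomp {b b' : X} (hb : b ∈ c) (hb' : b' ∈ c) (hlt : b.1.1 < b'.1.1) : r b b' := by
      rcases hc hb hb' (by rintro rfl; exact lt_irrefl _ hlt) with h1 | h1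
      · exact h1
      · exact absurd h1.1 (not_le.2 hlt)
    have hcomp' {b b' : X} (hb : b ∈ c) (hb' : b' ∈ c) : intrinsicEDist M b.1.2 b'.1.2 ≤
        ENNReal.ofReal (2 * ‖v‖ * |b'.1.1 - b.1.1|) := by
      rcases eq_or_ne b b' with rfl | hbb
      · simp [intrinsicEDist_self b.2.2.2.1]
      rcases hc hb hb' hbb with h1 | h1
      · rw [abs_of_nonneg (by linarith [h1.1])]; exact h1.2
      · rw [abs_sub_comm, abs_of_nonneg (by linarith [h1.1]), intrinsicEDist_comm]; exact h1.2
    -- Otherwise times in the chain converge to the supremum, and the corresponding points are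
    -- intrinsically Cauchy. Completeness supplies the endpoint at the supremal time.
    obtain ⟨x, hxM, hx⟩ := hC (fun k => (a k).1.2) (fun k => (a k).2.2.2.1) (fun ε hε => by
      have h1 : Tendsto (fun kl : ℕ × ℕ => ENNReal.ofReal (2 * ‖v‖ * |t kl.2 - t kl.1|))
          (atTop ×ˢ atTop) (𝓝 (ENNReal.ofReal (2 * ‖v‖ * |sSup S - sSup S|))) :=
        ENNReal.tendsto_ofReal ((((htlim.comp tendsto_snd).sub
          (htlim.comp tendsto_fst)).abs).const_mul _)
      rw [sub_self, abs_zero, mul_zero, ENNReal.ofReal_zero, prod_atTop_atTop_eq] at h1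
      obtain ⟨⟨N₁, N₂⟩, hN⟩ := eventually_atTop.1 (h1.eventually (gt_mem_nhds hε))
      refine ⟨max N₁ N₂, fun k hk l hl => (hcomp' (hac k) (hac l)).trans_lt ?_⟩
      have h2 := hN (k, l) ⟨(le_max_left _ _).trans hk, (le_max_right _ _).trans hl⟩
      rw [← hat k, ← hat l] at h2
      exact h2)
    have hxlim : Tendsto (fun k => (a k).1.2) atTop (𝓝 x) := by
      rw [tendsto_iff_edist_tendsto_0]
      exact tendsto_of_tendsto_of_tendsto_of_le_of_le tendsto_const_nhds hx (fun _ => zero_le)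
        (fun k => edist_le_intrinsicEDist M _ _)
    have hat' : Tendsto (fun k => (a k).1.1) atTop (𝓝 (sSup S)) := by
      simpa only [hat] using htlim
    have hdist {y : Ambient n} {s : ℝ} (hy : ∀ᶠ k in atTop, intrinsicEDist M y (a k).1.2 ≤
        ENNReal.ofReal (2 * ‖v‖ * ((a k).1.1 - s))) :
        intrinsicEDist M y x ≤ ENNReal.ofReal (2 * ‖v‖ * (sSup S - s)) := by
      have h1 : Tendsto (fun k => ENNReal.ofReal (2 * ‖v‖ * ((a k).1.1 - s)) +
          intrinsicEDist M (a k).1.2 x) atTop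
          (𝓝 (ENNReal.ofReal (2 * ‖v‖ * (sSup S - s)) + 0)) :=
        (ENNReal.tendsto_ofReal ((hat'.sub_const s).const_mul _)).add hx
      rw [add_zero] at h1
      refine ge_of_tendsto h1 ?_
      filter_upwards [hy] with k hk
      exact (intrinsicEDist_triangle M _ (a k).1.2 _).trans (by gcongr)
    have hX : (sSup S, x) ∈ X := by
      refine ⟨?_, csSup_le hSne (by rintro _ ⟨a, -, rfl⟩; exact a.2.2.1), hxM, ?_, ?_, ?_⟩
      · exact ge_of_tendsto hat' (.of_forall fun k => (a k).2.1)
      · refine tendsto_nhds_unique (((orthPart e).continuous.tendsto _).comp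
          (hxlim.sub_const q)) ?_
        refine (hat'.smul_const v).congr fun k => ?_
        exact (a k).2.2.2.2.1.symm
      · have h1 : Tendsto (fun k => normalSq M (a k).1.2 e) atTop (𝓝 (normalSq M x e)) :=
          ((hM.continuousOn_normalSq e x hxM).tendsto).comp
            (tendsto_nhdsWithin_iff.2 ⟨hxlim, .of_forall fun k => (a k).2.2.2.1⟩)
        exact le_of_tendsto_of_tendsto' ((hat'.const_mul _).const_sub 1) h1
          fun k => (a k).2.2.2.2.2.1
      · have h1 := hdist (y := q) (s := 0) (.of_forall fun k => by
          simpa using (a k).2.2.2.2.2.2)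
        simpa using h1
    refine ⟨⟨_, hX⟩, fun b hb => ⟨hle hb, hdist ?_⟩⟩
    have h1 : b.1.1 < sSup S := lt_of_le_of_ne (hle hb) (hatt b hb)
    filter_upwards [hat'.eventually (lt_mem_nhds h1)] with k hk
    exact (hcomp hb (hac k) hk).2
  obtain ⟨⟨⟨t, x⟩, hx⟩, hmax⟩ := exists_maximal_of_chains_bounded hchain htrans
  obtain ⟨ht0, ht1, hxM, hxv, hxw, hxd⟩ := id hx
  simp only at ht0 ht1 hxM hxv hxw hxd
  rcases ht1.eq_or_lt with rfl | hlt
  · exact ⟨x, hxM, by simpa using hxv, by simpa using hxd⟩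
  exfalso
  -- Since ‖v‖ ≤ 1/16 and t < 1, the tilt is at least 1 − 4‖v‖t ≥ 3/4 > 1/2, so the lift can be
  -- continued past a maximal time below 1.
  obtain ⟨s₀, hs₀, hstep⟩ := hM.exists_lift_step hA hxM he hv
    (by nlinarith [norm_nonneg v])
  obtain ⟨y, hyM, hyv, hyd, hyw⟩ := hstep (min s₀ (1 - t)) (lt_min hs₀ (by linarith))
    (min_le_left _ _)
  set s := min s₀ (1 - t) with hs
  have hs1 : s ≤ 1 - t := min_le_right _ _
  have hs2 : 0 < s := lt_min hs₀ (by linarith)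
  have hy : (t + s, y) ∈ X := by
    refine ⟨by simp only; linarith, by simp only; linarith, hyM, ?_, by simp only; linarith, ?_⟩
    · simp only
      rw [← sub_add_sub_cancel y x q, map_add, hyv, hxv, add_smul, add_comm]
    · refine (intrinsicEDist_triangle M _ x _).trans ((add_le_add hxd hyd).trans ?_)
      rw [← ENNReal.ofReal_add (by positivity) (by positivity)]
      exact ENNReal.ofReal_le_ofReal (by simp only; linarith)
  have h1 := hmax ⟨_, hy⟩ ⟨by simp only; linarith, by simpa using hyd⟩
  have h2 : t + s ≤ t := h1.1
  linarith

end Lifting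

/-! ### Volume lower bounds, total boundedness and closedness -/

section Proper

variable {n : ℕ} {M : Set (Ambient n)}

theorem LipschitzOnWith.euclideanHausdorffMeasure_image_le {X Y : Type*} [EMetricSpace X]
    [EMetricSpace Y] [MeasurableSpace X] [BorelSpace X] [MeasurableSpace Y] [BorelSpace Y]
    {K : ℝ≥0} {f : X → Y} {s : Set X} (h : LipschitzOnWith K f s) (d : ℕ) :
    Measure.euclideanHausdorffMeasure d (f '' s) ≤
      (K : ℝ≥0∞) ^ d * Measure.euclideanHausdorffMeasure d s := by
  have h1 := h.hausdorffMeasure_image_le (Nat.cast_nonneg (α := ℝ) d)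
  rw [ENNReal.rpow_natCast] at h1
  simp only [Measure.euclideanHausdorffMeasure_def, Measure.smul_apply, ENNReal.smul_def,
    smul_eq_mul]
  rw [mul_left_comm]
  gcongr

/-- The volume of intrinsic balls is bounded below. -/
theorem IsSmoothHypersurface.volume_ball_le (hM : IsSmoothHypersurface M)
    (hC : IsIntrinsicallyComplete M)
    (hA : ∀ U ν, IsUnitNormalField M U ν → ∀ p ∈ M ∩ U, normSqSecondFundamentalForm M ν p < 1)
    {q : Ambient n} (hq : q ∈ M) {ρ : ℝ} (hρ : ρ ≤ 1 / 16) {ε : ℝ≥0∞}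
    (hε : ENNReal.ofReal (2 * ρ) ≤ ε) :
    volume (Metric.ball (0 : EuclideanSpace ℝ (Fin n)) ρ) ≤
      Measure.euclideanHausdorffMeasure n {x ∈ M | intrinsicEDist M q x < ε} := by
  obtain ⟨e, he, hT⟩ := hM.exists_unit_normal hq
  have he0 : e ≠ 0 := by rintro rfl; simp at he
  have : Fact (Module.finrank ℝ (Ambient n) = n + 1) := ⟨by simp⟩
  let b := OrthonormalBasis.fromOrthogonalSpanSingleton (𝕜 := ℝ) n he0
  let L : EuclideanSpace ℝ (Fin n) → Ambient n := fun y => (b.repr.symm y : Ambient n)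
  have hL : Isometry L := isometry_subtype_coe.comp b.repr.symm.isometry
  have hLe (y) : ⟪e, L y⟫_ℝ = 0 :=
    Submodule.mem_orthogonal_singleton_iff_inner_right.1 (b.repr.symm y).2
  have hLn (y) : ‖L y‖ = ‖y‖ := b.repr.symm.norm_map y
  -- Orthogonal projection to the tangent plane does not increase measure, and by `exists_lift` the
  -- image of the intrinsic ball contains the flat ball of radius ρ.
  have hlip : LipschitzOnWith 1 (fun x => orthPart e (x - q)) {x ∈ M | intrinsicEDist M q x < ε} :=
    (LipschitzWith.of_dist_le_mul fun x y => by
      rw [dist_eq_norm, dist_eq_norm, ← map_sub, sub_sub_sub_cancel_right, NNReal.coe_one, one_mul]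
      exact norm_orthPart_le he _).lipschitzOnWith
  have h1 := hlip.euclideanHausdorffMeasure_image_le n
  rw [ENNReal.coe_one, one_pow, one_mul] at h1
  refine le_trans ?_ h1
  rw [← EuclideanSpace.euclideanHausdorffMeasure_eq_volume n, ← hL.euclideanHausdorffMeasure_image]
  refine measure_mono ?_
  rintro _ ⟨y, hy, rfl⟩
  have hyρ : ‖y‖ < ρ := by simpa using hy
  obtain ⟨x, hx, hxy, hd⟩ := hM.exists_lift hC hA hq he hT (hLe y) (by rw [hLn]; linarith)
  refine ⟨x, ⟨hx, hd.trans_lt (lt_of_lt_of_le ?_ hε)⟩, hxy⟩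
  rw [hLn]
  exact (ENNReal.ofReal_lt_ofReal_iff (by linarith [norm_nonneg y])).2 (by linarith)

/-- A packing argument. Failure of total boundedness yields an infinite ε-separated sequence; the
small intrinsic balls around it are disjoint, have volume bounded below, and lie in a Euclidean ball
in which M has finite volume. -/
theorem IsSmoothHypersurface.totallyBounded (hM : IsSmoothHypersurface M)
    (hC : IsIntrinsicallyComplete M)
    (hA : ∀ U ν, IsUnitNormalField M U ν → ∀ p ∈ M ∩ U, normSqSecondFundamentalForm M ν p < 1)
    (hV : HasPolynomialVolumeGrowth M) (R : ℝ) :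
    TotallyBounded {x : IntrinsicSpace M | ‖x.val‖ ≤ R} := by
  rw [EMetric.totallyBounded_iff]
  intro ε hε
  by_contra! hcon
  obtain ⟨u, huR, hu⟩ := exists_seq_of_forall_finset_exists
    (fun x : IntrinsicSpace M => ‖x.val‖ ≤ R) (fun x y => ε ≤ edist y x) (fun s _ => by
      have h1 := hcon s s.finite_toSet
      rw [not_subset] at h1
      obtain ⟨y, hy, hys⟩ := h1
      refine ⟨y, hy, fun x hx => ?_⟩
      simp only [mem_iUnion, not_exists] at hys
      simpa using hys x hx)
  -- The bound 1/16 is the range of the lifting lemma, and 2ρ ≤ ε/2 makes the balls disjoint. The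
  -- minimum with 1 covers ε = ∞.
  obtain ⟨ρ, hρ0, hρ, hρε⟩ : ∃ ρ : ℝ, 0 < ρ ∧ ρ ≤ 1 / 16 ∧ ENNReal.ofReal (2 * ρ) ≤ ε / 2 := by
    have h1 : 0 < min (ε / 2) 1 := lt_min (ENNReal.half_pos hε.ne') one_pos
    have h2 : min (ε / 2) 1 ≠ ⊤ := ne_top_of_le_ne_top ENNReal.one_ne_top (min_le_right _ _)
    have h3 := ENNReal.toReal_pos h1.ne' h2
    refine ⟨min (1 / 16) ((min (ε / 2) 1).toReal / 2), lt_min (by norm_num) (by linarith),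
      min_le_left _ _, (ENNReal.ofReal_le_of_le_toReal ?_).trans (min_le_left _ 1)⟩
    linarith [min_le_right (1 / 16) ((min (ε / 2) 1).toReal / 2)]
  have hball (k : ℕ) : ∃ O : Set (Ambient n), IsOpen O ∧
      IntrinsicSpace.val ⁻¹' O = Metric.eball (u k) (ENNReal.ofReal (2 * ρ)) :=
    hM.isInducing_val.isOpen_iff.1 Metric.isOpen_eball
  choose O hO hOb using hball
  have hOM (k : ℕ) : O k ∩ M = {x ∈ M | intrinsicEDist M (u k).val x < ENNReal.ofReal (2 * ρ)} := by
    ext x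
    constructor
    · rintro ⟨h1, h2⟩
      have h3 : (⟨x, h2⟩ : IntrinsicSpace M) ∈ IntrinsicSpace.val (M := M) ⁻¹' O k := h1
      rw [hOb, Metric.mem_eball, edist_comm] at h3
      exact ⟨h2, h3⟩
    · rintro ⟨h2, h1⟩
      refine ⟨?_, h2⟩
      have h3 : (⟨x, h2⟩ : IntrinsicSpace M) ∈ Metric.eball (u k) (ENNReal.ofReal (2 * ρ)) := by
        rw [Metric.mem_eball, edist_comm]
        exact h1
      rw [← hOb] at h3
      exact h3
  -- Measuring the ambient open sets `O k` by the restriction to M avoids any question about the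
  -- measurability of M; they need to be disjoint only on M.
  set μ := (Measure.euclideanHausdorffMeasure n : Measure (Ambient n)).restrict M with hμ
  have hdisj : Pairwise (Function.onFun (AEDisjoint μ) O) := by
    have key : ∀ k l, k < l → μ (O k ∩ O l) = 0 := by
      intro k l hkl
      rw [hμ, Measure.restrict_apply ((hO k).inter (hO l)).measurableSet]
      have : O k ∩ O l ∩ M = ∅ := by
        rw [eq_empty_iff_forall_notMem]
        rintro x ⟨⟨h1, h2⟩, h3⟩
        have h4 := ((hOM k).le ⟨h1, h3⟩).2
        have h5 := ((hOM l).le ⟨h2, h3⟩).2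
        have h6 : ε ≤ intrinsicEDist M (u l).val (u k).val := hu k l hkl
        rw [intrinsicEDist_comm] at h4
        have h7 := (h6.trans (intrinsicEDist_triangle M _ x _)).trans_lt (ENNReal.add_lt_add h5 h4)
        refine absurd h7 (not_lt.2 ?_)
        calc _ ≤ ε / 2 + ε / 2 := by gcongr
          _ = ε := ENNReal.add_halves ε
      rw [this, measure_empty]
    intro k l hkl
    rcases lt_or_gt_of_ne hkl with h | h
    · exact key k l h
    · change μ (O k ∩ O l) = 0
      rw [inter_comm]; exact key l k h
  have hfin : μ (⋃ k, O k) ≠ ⊤ := by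
    obtain ⟨C, d, hCd⟩ := hV
    -- The balls have intrinsic radius 2ρ ≤ 1/8, so all of them lie in the Euclidean ball of radius
    -- |R| + 1.
    have hr : (1 : ℝ≥0) ≤ (|R| + 1).toNNReal := by
      rw [Real.one_le_toNNReal]; linarith [abs_nonneg R]
    have h1 := hCd _ hr
    rw [hμ, Measure.restrict_apply (isOpen_iUnion hO).measurableSet]
    refine ne_top_of_le_ne_top (by finiteness) ((measure_mono ?_).trans h1)
    rintro x ⟨hx, hxM⟩
    obtain ⟨k, hk⟩ := mem_iUnion.1 hx
    refine ⟨hxM, ?_⟩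
    have h2 := (edist_le_intrinsicEDist M _ _).trans_lt ((hOM k).le ⟨hk, hxM⟩).2
    rw [edist_dist, ENNReal.ofReal_lt_ofReal_iff (by linarith), dist_comm, dist_eq_norm] at h2
    rw [mem_ball_zero_iff, Real.coe_toNNReal _ (by positivity)]
    have h3 := norm_le_norm_add_norm_sub' x (u k).val
    linarith [huR k, le_abs_self R]
  have h1 := Measure.finite_const_le_meas_of_disjoint_iUnion₀ μ
    (Metric.measure_ball_pos volume (0 : EuclideanSpace ℝ (Fin n)) hρ0)
    (fun k => (hO k).measurableSet.nullMeasurableSet) hdisj hfin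
  refine infinite_univ (h1.subset fun k _ => ?_)
  change _ ≤ μ (O k)
  rw [hμ, Measure.restrict_apply (hO k).measurableSet, hOM]
  exact hM.volume_ball_le hC hA (u k).val_mem hρ le_rfl

/-- The part of M in a closed Euclidean ball is complete and totally bounded for the intrinsic
distance, hence compact, and the inclusion into Euclidean space is continuous. -/
theorem IsSmoothHypersurface.isClosed_of_isIntrinsicallyComplete (hM : IsSmoothHypersurface M)
    (hC : IsIntrinsicallyComplete M)
    (hA : ∀ U ν, IsUnitNormalField M U ν → ∀ p ∈ M ∩ U, normSqSecondFundamentalForm M ν p < 1)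
    (hV : HasPolynomialVolumeGrowth M) : IsClosed M := by
  have := hC.completeSpace
  have hK (R : ℝ) : IsCompact (M ∩ Metric.closedBall 0 R) := by
    have h1 : IsCompact {x : IntrinsicSpace M | ‖x.val‖ ≤ R} :=
      (hM.totallyBounded hC hA hV R).isCompact_of_isClosed
        (isClosed_le (IntrinsicSpace.continuous_val.norm) continuous_const)
    convert h1.image IntrinsicSpace.continuous_val using 1
    ext x
    constructor
    · rintro ⟨h2, h3⟩
      exact ⟨(⟨x, h2⟩ : IntrinsicSpace M), by simpa using h3, rfl⟩
    · rintro ⟨y, hy, rfl⟩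
      exact ⟨y.val_mem, by simpa using hy⟩
  refine IsSeqClosed.isClosed fun u p hu hp => ?_
  obtain ⟨R, hR⟩ := hp.norm.bddAbove_range
  exact ((hK R).isClosed.mem_of_tendsto hp
    (.of_forall fun k => ⟨hu k, by simpa using hR ⟨k, rfl⟩⟩)).1

theorem IsSelfShrinker.isHyperplane (hM : IsSmoothHypersurface M) (hne : M.Nonempty)
    (hC : IsIntrinsicallyComplete M) (hV : HasPolynomialVolumeGrowth M) (hS : IsSelfShrinker M)
    (hA : ∀ U ν, IsUnitNormalField M U ν → ∀ p ∈ M ∩ U, normSqSecondFundamentalForm M ν p < 1) :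
    IsHyperplane M :=
  have hcl := hM.isClosed_of_isIntrinsicallyComplete hC hA hV
  hM.isHyperplane_of_normalSq_self_eq_zero hcl hne fun _ hp =>
    hS.normalSq_self_eq_zero hM hA hcl hp

end Proper

/-! ### Comparison of unit normal fields -/

section NormalField

variable {n : ℕ} {M : Set (Ambient n)}

/-- Tangential derivatives are derivatives along curves in M, so they see only the values on M and
not the chosen extension. -/
theorem fderiv_eq_of_eventuallyEq_nhdsWithin {ν N : Ambient n → Ambient n} {p : Ambient n}
    (hν : DifferentiableAt ℝ ν p) (hN : DifferentiableAt ℝ N p) (h : ν =ᶠ[𝓝[M] p] N)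
    {u : Ambient n} (hu : u ∈ tangentSubspace M p) : fderiv ℝ ν p u = fderiv ℝ N p u := by
  induction hu using Submodule.span_induction with
  | mem v hv =>
    obtain ⟨γ, rfl, hγM, hγ⟩ := hv
    have h1 := hν.hasFDerivAt.comp_hasDerivAt 0 hγ
    have h2 := hN.hasFDerivAt.comp_hasDerivAt 0 hγ
    exact h1.unique (h2.congr_of_eventuallyEq
      ((tendsto_nhdsWithin_iff.2 ⟨hγ.continuousAt, hγM⟩).eventually h))
  | zero => simp
  | add x y _ _ hx hy => rw [map_add, map_add, hx, hy]
  | smul a x _ hx => rw [map_smul, map_smul, hx]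

/-- Two unit normal fields agree up to sign, with their tangential derivatives. -/
theorem IsUnitNormalField.exists_sign {U : Set (Ambient n)} {ν N : Ambient n → Ambient n}
    (hν : IsUnitNormalField M U ν) {p : Ambient n} (hp : p ∈ M ∩ U) (hN : DifferentiableAt ℝ N p)
    (hN1 : ∀ x ∈ M, ‖N x‖ = 1)
    (hNT : ∀ x ∈ M, ∀ v, v ∈ tangentSubspace M x ↔ ⟪N x, v⟫_ℝ = 0) :
    ∃ σ : ℝ, σ ^ 2 = 1 ∧ ν p = σ • N p ∧
      ∀ u ∈ tangentSubspace M p, fderiv ℝ ν p u = σ • fderiv ℝ N p u := by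
  have hνd := hν.contDiffOn.differentiableAt_of_isOpen hν.isOpen hp.2
  obtain ⟨σ, hσ, hσp⟩ : ∃ σ : ℝ, σ ^ 2 = 1 ∧ ν p = σ • N p := by
    rcases eq_or_eq_neg_of_orthogonal (hN1 p hp.1) (hNT p hp.1) (hν.norm_eq_one p hp)
      (hν.inner_eq_zero p hp) with h | h
    · exact ⟨1, by norm_num, by simpa using h⟩
    · exact ⟨-1, by norm_num, by simpa using h⟩
  refine ⟨σ, hσ, hσp, fun u hu => ?_⟩
  -- By continuity the inner product stays positive, which excludes the opposite sign near `p`.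
  have hpos : ∀ᶠ x in 𝓝 p, 0 < ⟪ν x, σ • N x⟫_ℝ := by
    have h1 : ContinuousAt (fun x => ⟪ν x, σ • N x⟫_ℝ) p :=
      hνd.continuousAt.inner (hN.continuousAt.const_smul σ)
    refine h1.eventually (lt_mem_nhds ?_)
    change 0 < ⟪ν p, σ • N p⟫_ℝ
    rw [hσp, real_inner_self_eq_norm_sq, norm_smul, hN1 p hp.1, mul_one, Real.norm_eq_abs, sq_abs,
      hσ]
    exact one_pos
  have heq : ν =ᶠ[𝓝[M] p] fun x => σ • N x := by
    filter_upwards [self_mem_nhdsWithin, mem_nhdsWithin_of_mem_nhds hpos,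
      mem_nhdsWithin_of_mem_nhds (hν.isOpen.mem_nhds hp.2)] with x hxM hx hxU
    have h1 : ‖σ • N x‖ = 1 := by
      rw [norm_smul, hN1 x hxM, mul_one, Real.norm_eq_abs, ← sq_eq_sq₀ (abs_nonneg σ) zero_le_one,
        sq_abs, hσ, one_pow]
    have hσ0 : σ ≠ 0 := by rintro rfl; norm_num at hσ
    rcases eq_or_eq_neg_of_orthogonal h1 (fun v => by
      rw [hNT x hxM, inner_smul_left, mul_eq_zero, or_iff_right (by simpa using hσ0)])
      (hν.norm_eq_one x ⟨hxM, hxU⟩) (hν.inner_eq_zero x ⟨hxM, hxU⟩) with h | h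
    · exact h
    · rw [h, inner_neg_left, real_inner_self_eq_norm_sq, h1] at hx
      norm_num at hx
  rw [fderiv_eq_of_eventuallyEq_nhdsWithin hνd (hN.const_smul σ) heq hu, fderiv_const_smul hN]
  rfl

end NormalField

/-! ### The shrinking cylinders -/

section Cylinder

variable {n : ℕ}

/-- The orthogonal projection of `ℝ^{n+1} = ℝ^k × ℝ^{n-k+1}` to the second factor. -/
noncomputable def tailProj (n k : ℕ) : Ambient n →L[ℝ] Ambient n :=
  LinearMap.toContinuousLinearMap
    { toFun := fun x => WithLp.toLp 2 fun i => if k ≤ i.val then x i else 0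
      map_add' := fun x y => by ext i; simp only [PiLp.add_apply]; split_ifs <;> simp
      map_smul' := fun c x => by ext i; simp }

theorem tailProj_apply (n k : ℕ) (x : Ambient n) (i : Fin (n + 1)) :
    tailProj n k x i = if k ≤ i.val then x i else 0 := rfl

theorem inner_tailProj (n k : ℕ) (x y : Ambient n) :
    ⟪tailProj n k x, y⟫_ℝ = ∑ i : Fin (n + 1) with k ≤ i.val, x i * y i := by
  rw [PiLp.inner_apply, Finset.sum_filter]
  refine Finset.sum_congr rfl fun i _ => ?_
  rw [tailProj_apply]
  split_ifs <;> simp [mul_comm]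

theorem inner_tailProj_comm (n k : ℕ) (x y : Ambient n) :
    ⟪tailProj n k x, y⟫_ℝ = ⟪x, tailProj n k y⟫_ℝ := by
  rw [real_inner_comm (tailProj n k y), inner_tailProj, inner_tailProj]
  simp [mul_comm]

theorem tailProj_tailProj (n k : ℕ) (x : Ambient n) :
    tailProj n k (tailProj n k x) = tailProj n k x := by
  ext i
  simp only [tailProj_apply]
  split_ifs <;> rfl

theorem norm_sq_tailProj (n k : ℕ) (x : Ambient n) :
    ‖tailProj n k x‖ ^ 2 = ⟪tailProj n k x, x⟫_ℝ := by
  rw [← real_inner_self_eq_norm_sq, ← inner_tailProj_comm, tailProj_tailProj]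

theorem mem_shrinkingCylinder_iff {k : ℕ} (hk : k < n) (x : Ambient n) :
    x ∈ shrinkingCylinder n k ↔ ⟪tailProj n k x, x⟫_ℝ = (n : ℝ) - k := by
  have h1 : (k : ℝ) ≤ n := by exact_mod_cast hk.le
  rw [inner_tailProj]
  change √_ = √_ ↔ _
  rw [Real.sqrt_inj (Finset.sum_nonneg fun i _ => sq_nonneg _) (by linarith)]
  simp [sq]

theorem hasFDerivAt_inner_tailProj (n k : ℕ) (x : Ambient n) :
    HasFDerivAt (fun x => ⟪tailProj n k x, x⟫_ℝ - ((n : ℝ) - k))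
      ((2 : ℝ) • innerSL ℝ (tailProj n k x)) x := by
  have h1 := ((tailProj n k).hasFDerivAt (x := x)).inner ℝ (hasFDerivAt_id x)
  refine (h1.sub_const _).congr_fderiv ?_
  ext v
  have h2 : ⟪tailProj n k v, x⟫_ℝ = ⟪tailProj n k x, v⟫_ℝ := by
    rw [inner_tailProj_comm, real_inner_comm]
  simp [fderivInnerCLM_apply, h2, two_mul]

theorem shrinkingCylinder_inter_eq {k : ℕ} (hk : k < n) :
    shrinkingCylinder n k ∩ {x | tailProj n k x ≠ 0} =
      {x ∈ {x | tailProj n k x ≠ 0} | ⟪tailProj n k x, x⟫_ℝ - ((n : ℝ) - k) = 0} := by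
  ext x
  rw [mem_inter_iff, mem_shrinkingCylinder_iff hk, and_comm, ← sub_eq_zero]
  rfl

theorem isOpen_tailProj_ne (n k : ℕ) : IsOpen {x : Ambient n | tailProj n k x ≠ 0} :=
  isOpen_ne.preimage (tailProj n k).continuous

theorem contDiff_inner_tailProj (n k : ℕ) :
    ContDiff ℝ ∞ (fun x : Ambient n => ⟪tailProj n k x, x⟫_ℝ - ((n : ℝ) - k)) :=
  ((tailProj n k).contDiff.inner ℝ contDiff_id).sub contDiff_const

theorem tailProj_ne_zero {k : ℕ} (hk : k < n) {x : Ambient n} (hx : x ∈ shrinkingCylinder n k) :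
    tailProj n k x ≠ 0 := by
  intro h0
  rw [mem_shrinkingCylinder_iff hk, h0, inner_zero_left] at hx
  have : (k : ℝ) < n := by exact_mod_cast hk
  linarith

theorem fderiv_inner_tailProj_ne_zero {k : ℕ} {x : Ambient n} (hx : tailProj n k x ≠ 0) :
    fderiv ℝ (fun x => ⟪tailProj n k x, x⟫_ℝ - ((n : ℝ) - k)) x ≠ 0 := by
  rw [(hasFDerivAt_inner_tailProj n k x).fderiv]
  intro h0
  have h1 := DFunLike.congr_fun h0 (tailProj n k x)
  simp at h1
  exact hx h1

theorem isSmoothHypersurface_shrinkingCylinder {k : ℕ} (hk : k < n) :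
    IsSmoothHypersurface (shrinkingCylinder n k) := fun _ hp =>
  ⟨_, _, isOpen_tailProj_ne n k, tailProj_ne_zero hk hp, (contDiff_inner_tailProj n k).contDiffOn,
    fun _ hq => fderiv_inner_tailProj_ne_zero hq, shrinkingCylinder_inter_eq hk⟩

theorem mem_tangentSubspace_shrinkingCylinder {k : ℕ} (hk : k < n) {x : Ambient n}
    (hx : x ∈ shrinkingCylinder n k) (v : Ambient n) :
    v ∈ tangentSubspace (shrinkingCylinder n k) x ↔ ⟪tailProj n k x, v⟫_ℝ = 0 := by
  have h1 : ⟪tailProj n k x, v⟫_ℝ = 0 ↔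
      fderiv ℝ (fun x => ⟪tailProj n k x, x⟫_ℝ - ((n : ℝ) - k)) x v = 0 := by
    rw [(hasFDerivAt_inner_tailProj n k x).fderiv]
    simp
  have hx0 := tailProj_ne_zero hk hx
  rw [h1]
  exact ⟨fderiv_eq_zero_of_mem_tangentSubspace (isOpen_tailProj_ne n k)
    (contDiff_inner_tailProj n k).contDiffOn (shrinkingCylinder_inter_eq hk) hx0,
    mem_tangentSubspace_of_fderiv_eq_zero (isOpen_tailProj_ne n k)
    (contDiff_inner_tailProj n k).contDiffOn (shrinkingCylinder_inter_eq hk) hx hx0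
    (fderiv_inner_tailProj_ne_zero hx0)⟩

theorem isClosed_shrinkingCylinder {k : ℕ} (hk : k < n) : IsClosed (shrinkingCylinder n k) := by
  have : shrinkingCylinder n k = {x | ⟪tailProj n k x, x⟫_ℝ = (n : ℝ) - k} :=
    Set.ext (mem_shrinkingCylinder_iff hk)
  rw [this]
  exact isClosed_eq (by fun_prop) continuous_const

theorem nonempty_shrinkingCylinder {k : ℕ} (hk : k < n) : (shrinkingCylinder n k).Nonempty := by
  have h1 : (k : ℝ) ≤ n := by exact_mod_cast hk.le
  refine ⟨EuclideanSpace.single (Fin.last n) √((n : ℝ) - k), ?_⟩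
  rw [mem_shrinkingCylinder_iff hk, EuclideanSpace.inner_single_right, tailProj_apply,
    if_pos (by simpa using hk.le)]
  simp [Real.mul_self_sqrt (sub_nonneg.2 h1)]

/-- The cylinder is symmetric under x ↦ −x, so a hyperplane equal to it would pass through 0, which
is not on the cylinder. -/
theorem not_isHyperplane_shrinkingCylinder {k : ℕ} (hk : k < n) :
    ¬ IsHyperplane (shrinkingCylinder n k) := by
  rintro ⟨w, c, -, hM⟩
  obtain ⟨x, hx⟩ := nonempty_shrinkingCylinder hk
  have hx' : -x ∈ shrinkingCylinder n k := by
    rw [mem_shrinkingCylinder_iff hk] at hx ⊢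
    simpa using hx
  have h1 : ⟪w, x⟫_ℝ = c := hM.le hx
  have h2 : ⟪w, -x⟫_ℝ = c := hM.le hx'
  rw [inner_neg_right] at h2
  have h3 : (0 : Ambient n) ∈ shrinkingCylinder n k :=
    hM.ge (show ⟪w, 0⟫_ℝ = c by rw [inner_zero_right]; linarith)
  exact tailProj_ne_zero hk h3 (map_zero _)

theorem sum_inner_tailProj_basis {k : ℕ} (hk : k ≤ n) :
    ∑ i, ⟪tailProj n k (EuclideanSpace.basisFun (Fin (n + 1)) ℝ i),
      EuclideanSpace.basisFun (Fin (n + 1)) ℝ i⟫_ℝ = (n : ℝ) - k + 1 := by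
  have h1 (i : Fin (n + 1)) : ⟪tailProj n k (EuclideanSpace.basisFun (Fin (n + 1)) ℝ i),
      EuclideanSpace.basisFun (Fin (n + 1)) ℝ i⟫_ℝ = if k ≤ i.val then 1 else 0 := by
    rw [EuclideanSpace.basisFun_apply, EuclideanSpace.inner_single_right, tailProj_apply]
    simp
  rw [Finset.sum_congr rfl fun i _ => h1 i, Fin.sum_univ_eq_sum_range (fun i => if k ≤ i then 1 else 0),
    Finset.sum_ite, Finset.sum_const_zero, add_zero, Finset.sum_const, nsmul_eq_mul, mul_one]
  have h2 : (Finset.range (n + 1)).filter (k ≤ ·) = Finset.Ico k (n + 1) := by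
    ext i; simp [and_comm]
  rw [h2, Nat.card_Ico, Nat.cast_sub (by omega)]
  push_cast
  ring

/-- The second fundamental form of the cylinder, for an arbitrary unit normal field. -/
theorem secondFundamentalForm_shrinkingCylinder {k : ℕ} (hk : k < n) {U : Set (Ambient n)}
    {ν : Ambient n → Ambient n} (hν : IsUnitNormalField (shrinkingCylinder n k) U ν)
    {p : Ambient n} (hp : p ∈ shrinkingCylinder n k ∩ U) :
    ∃ s : ℝ, s ^ 2 * ((n : ℝ) - k) = 1 ∧ ν p = s • tailProj n k p ∧
      ∀ u v : tangentSubspace (shrinkingCylinder n k) p,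
        secondFundamentalForm (shrinkingCylinder n k) ν p u v = s * ⟪tailProj n k u, v⟫_ℝ := by
  have hpos : 0 < (n : ℝ) - k := sub_pos.2 (by exact_mod_cast hk)
  have hR := Real.sqrt_pos.2 hpos
  obtain ⟨σ, hσ, hσp, hσd⟩ := hν.exists_sign (N := fun x => (√((n : ℝ) - k))⁻¹ • tailProj n k x) hp
    (by fun_prop) (fun x hx => by
      have h1 : ‖tailProj n k x‖ = √((n : ℝ) - k) := by
        rw [← (mem_shrinkingCylinder_iff hk x).1 hx, ← norm_sq_tailProj,
          Real.sqrt_sq (norm_nonneg _)]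
      rw [norm_smul, h1, norm_inv, Real.norm_of_nonneg hR.le, inv_mul_cancel₀ hR.ne'])
    (fun x hx v => by
      rw [mem_tangentSubspace_shrinkingCylinder hk hx, inner_smul_left, mul_eq_zero,
        or_iff_right (by simpa using hR.ne')])
  refine ⟨σ * (√((n : ℝ) - k))⁻¹, ?_, ?_, fun u v => ?_⟩
  · rw [mul_pow, hσ, inv_pow, Real.sq_sqrt hpos.le, one_mul, inv_mul_cancel₀ hpos.ne']
  · rw [hσp, smul_smul]
  · rw [secondFundamentalForm, hσd u u.2, fderiv_fun_const_smul (by fun_prop),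
      ContinuousLinearMap.fderiv]
    simp [inner_smul_left, mul_assoc]

theorem norm_unit_normal_shrinkingCylinder {k : ℕ} {s : ℝ}
    (hs : s ^ 2 * ((n : ℝ) - k) = 1) (hk : k < n) {p : Ambient n}
    (hp : p ∈ shrinkingCylinder n k) : ‖s • tailProj n k p‖ = 1 := by
  rw [← sq_eq_sq₀ (norm_nonneg _) zero_le_one, norm_smul, mul_pow, norm_sq_tailProj,
    (mem_shrinkingCylinder_iff hk p).1 hp, Real.norm_eq_abs, sq_abs, hs, one_pow]

/-- The projection has trace n − k + 1 on the whole space and fixes the unit normal, which accounts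
for 1. -/
theorem sum_inner_tailProj_tangent {k : ℕ} (hk : k < n) {p : Ambient n}
    (hp : p ∈ shrinkingCylinder n k) {s : ℝ} (hs : s ^ 2 * ((n : ℝ) - k) = 1) {ι : Type*}
    [Fintype ι] (t : OrthonormalBasis ι ℝ (tangentSubspace (shrinkingCylinder n k) p)) :
    ∑ i, ⟪tailProj n k (t i), (t i : Ambient n)⟫_ℝ = (n : ℝ) - k := by
  have hs0 : s ≠ 0 := by rintro rfl; norm_num at hs
  have h1 := t.sum_inner_add_inner_eq (EuclideanSpace.basisFun (Fin (n + 1)) ℝ)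
    (norm_unit_normal_shrinkingCylinder hs hk hp) (fun v => by
      rw [mem_tangentSubspace_shrinkingCylinder hk hp, inner_smul_left, mul_eq_zero,
        or_iff_right (by simpa using hs0)]) (tailProj n k)
  rw [sum_inner_tailProj_basis hk.le, map_smul, tailProj_tailProj, real_inner_self_eq_norm_sq,
    norm_unit_normal_shrinkingCylinder hs hk hp] at h1
  linarith

theorem isSelfShrinker_shrinkingCylinder {k : ℕ} (hk : k < n) :
    IsSelfShrinker (shrinkingCylinder n k) := by
  intro U ν hν p hp
  obtain ⟨s, hs, hsp, hsA⟩ := secondFundamentalForm_shrinkingCylinder hk hν hp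
  simp only [meanCurvature, hsA]
  rw [← Finset.mul_sum, sum_inner_tailProj_tangent hk hp.1 hs, hsp, inner_smul_right,
    real_inner_comm, (mem_shrinkingCylinder_iff hk p).1 hp.1]

/-- The projection P is symmetric, idempotent and preserves the tangent space, so ∑ⱼ ⟨Ptᵢ, tⱼ⟩² =
|Ptᵢ|² = ⟨Ptᵢ, tᵢ⟩. Hence |A|² is s² times the tangential trace of P, that is s²(n − k) = 1. -/
theorem normSqSecondFundamentalForm_shrinkingCylinder {k : ℕ} (hk : k < n) {U : Set (Ambient n)}
    {ν : Ambient n → Ambient n} (hν : IsUnitNormalField (shrinkingCylinder n k) U ν)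
    {p : Ambient n} (hp : p ∈ shrinkingCylinder n k ∩ U) :
    normSqSecondFundamentalForm (shrinkingCylinder n k) ν p = 1 := by
  obtain ⟨s, hs, hsp, hsA⟩ := secondFundamentalForm_shrinkingCylinder hk hν hp
  have hs0 : s ≠ 0 := by rintro rfl; norm_num at hs
  set t := stdOrthonormalBasis ℝ (tangentSubspace (shrinkingCylinder n k) p)
  have h1 (i) : ∑ j, ⟪tailProj n k (t i), (t j : Ambient n)⟫_ℝ ^ 2 =
      ⟪tailProj n k (t i), (t i : Ambient n)⟫_ℝ := by
    have h2 := t.sum_inner_sq_eq_norm_sq (norm_unit_normal_shrinkingCylinder hs hk hp.1) (fun v => by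
      rw [mem_tangentSubspace_shrinkingCylinder hk hp.1, inner_smul_left, mul_eq_zero,
        or_iff_right (by simpa using hs0)]) (tailProj n k (t i))
    have h3 : ⟪tailProj n k (t i), s • tailProj n k p⟫_ℝ = 0 := by
      rw [inner_smul_right, inner_tailProj_comm, tailProj_tailProj, real_inner_comm,
        (mem_tangentSubspace_shrinkingCylinder hk hp.1 _).1 (t i).2, mul_zero]
    rw [h3, norm_sq_tailProj, zero_pow two_ne_zero, add_zero] at h2
    exact h2
  simp only [normSqSecondFundamentalForm, hsA, mul_pow, ← Finset.mul_sum]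
  rw [Finset.sum_congr rfl fun i _ => h1 i, sum_inner_tailProj_tangent hk hp.1 hs, hs]

/-- The volume of a set on which some map is bounded below is controlled by that of its image. -/
theorem euclideanHausdorffMeasure_le_of_dist_le {X Y : Type*} [MetricSpace X] [Nonempty X]
    [MetricSpace Y] [MeasurableSpace X] [BorelSpace X] [MeasurableSpace Y] [BorelSpace Y]
    {K : ℝ≥0} {f : X → Y} {s : Set X}
    (h : ∀ x ∈ s, ∀ y ∈ s, dist x y ≤ K * dist (f x) (f y)) (d : ℕ) :
    Measure.euclideanHausdorffMeasure d s ≤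
      (K : ℝ≥0∞) ^ d * Measure.euclideanHausdorffMeasure d (f '' s) := by
  have hinj : InjOn f s := fun x hx y hy hxy => by
    have := h x hx y hy
    rw [hxy, dist_self, mul_zero] at this
    exact dist_le_zero.1 this
  have hl : LipschitzOnWith K (Function.invFunOn f s) (f '' s) := by
    refine LipschitzOnWith.of_dist_le_mul ?_
    rintro _ ⟨x, hx, rfl⟩ _ ⟨y, hy, rfl⟩
    rw [hinj.leftInvOn_invFunOn hx, hinj.leftInvOn_invFunOn hy]
    exact h x hx y hy
  have h1 := hl.euclideanHausdorffMeasure_image_le d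
  rwa [hinj.leftInvOn_invFunOn.image_image] at h1

theorem euclideanHausdorffMeasure_orthogonal_ball_le {e : Ambient n} (he : ‖e‖ = 1) {r : ℝ≥0}
    (hr : 0 < r) : Measure.euclideanHausdorffMeasure n {v : Ambient n | ⟪e, v⟫_ℝ = 0 ∧ ‖v‖ < r} ≤
      volume (Metric.ball (0 : EuclideanSpace ℝ (Fin n)) 1) * (r : ℝ≥0∞) ^ n := by
  have he0 : e ≠ 0 := by rintro rfl; simp at he
  have : Fact (Module.finrank ℝ (Ambient n) = n + 1) := ⟨by simp⟩
  let b := OrthonormalBasis.fromOrthogonalSpanSingleton (𝕜 := ℝ) n he0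
  let L : EuclideanSpace ℝ (Fin n) → Ambient n := fun y => (b.repr.symm y : Ambient n)
  have hL : Isometry L := isometry_subtype_coe.comp b.repr.symm.isometry
  have h1 : {v : Ambient n | ⟪e, v⟫_ℝ = 0 ∧ ‖v‖ < r} ⊆ L '' Metric.ball 0 r := by
    rintro v ⟨hv, hvr⟩
    refine ⟨b.repr ⟨v, Submodule.mem_orthogonal_singleton_iff_inner_right.2 hv⟩, ?_, ?_⟩
    · rw [mem_ball_zero_iff, LinearIsometryEquiv.norm_map]
      exact hvr
    · simp [L]
  refine (measure_mono h1).trans_eq ?_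
  rw [hL.euclideanHausdorffMeasure_image, EuclideanSpace.euclideanHausdorffMeasure_eq_volume,
    Measure.addHaar_ball_of_pos _ _ (NNReal.coe_pos.2 hr), mul_comm]
  simp [ENNReal.ofReal_pow]

/-- The part of the cylinder over which the direction `e` is transversal. -/
theorem euclideanHausdorffMeasure_cylinder_piece_le {k : ℕ} (hk : k < n) {e : Ambient n}
    (he : ‖e‖ = 1) (hee : tailProj n k e = e) {c : ℝ} (hc : 0 < c) {r : ℝ≥0} (hr : 0 < r) :
    Measure.euclideanHausdorffMeasure n
      ({x ∈ shrinkingCylinder n k | c ≤ ⟪e, x⟫_ℝ} ∩ Metric.ball 0 r) ≤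
      ((1 + √((n : ℝ) - k) / c).toNNReal : ℝ≥0∞) ^ n *
        (volume (Metric.ball (0 : EuclideanSpace ℝ (Fin n)) 1) * (r : ℝ≥0∞) ^ n) := by
  have hnorm {x : Ambient n} (hx : x ∈ shrinkingCylinder n k) :
      ‖tailProj n k x‖ = √((n : ℝ) - k) := by
    rw [← (mem_shrinkingCylinder_iff hk x).1 hx, ← norm_sq_tailProj, Real.sqrt_sq (norm_nonneg _)]
  have hK : 0 ≤ 1 + √((n : ℝ) - k) / c := by positivity
  refine (euclideanHausdorffMeasure_le_of_dist_le (K := (1 + √((n : ℝ) - k) / c).toNNReal)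
    (f := orthPart e) ?_ n).trans ?_
  · rintro x ⟨⟨hx, hxc⟩, -⟩ y ⟨⟨hy, hyc⟩, -⟩
    rw [dist_eq_norm, dist_eq_norm, ← map_sub, Real.coe_toNNReal _ hK]
    -- The difference of the equations for `x` and `y`. Its component along `e` is ⟨e, x − y⟩(⟨e, x⟩
    -- + ⟨e, y⟩), whose second factor is at least 2c, so the height difference is controlled by the
    -- orthogonal part.
    have h1 : ⟪x - y, tailProj n k (x + y)⟫_ℝ = 0 := by
      have hx' := (mem_shrinkingCylinder_iff hk x).1 hx
      have hy' := (mem_shrinkingCylinder_iff hk y).1 hy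
      rw [← inner_tailProj_comm, map_sub, inner_sub_left, inner_add_right, inner_add_right, hx', hy',
        inner_tailProj_comm n k y x, real_inner_comm]
      ring
    rw [← orthPart_add_smul e (x - y), inner_add_left, inner_smul_left,
      ← inner_tailProj_comm n k e, hee, inner_add_right] at h1
    simp only [conj_trivial] at h1
    have h2 : |⟪orthPart e (x - y), tailProj n k (x + y)⟫_ℝ| ≤
        ‖orthPart e (x - y)‖ * (2 * √((n : ℝ) - k)) := by
      refine (abs_real_inner_le_norm _ _).trans ?_
      gcongr
      rw [map_add]
      refine (norm_add_le _ _).trans_eq ?_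
      rw [hnorm hx, hnorm hy]
      ring
    have h3 : |⟪e, x - y⟫_ℝ| * (2 * c) ≤ ‖orthPart e (x - y)‖ * (2 * √((n : ℝ) - k)) := by
      refine le_trans ?_ h2
      rw [show ⟪orthPart e (x - y), tailProj n k (x + y)⟫_ℝ =
        -(⟪e, x - y⟫_ℝ * (⟪e, x⟫_ℝ + ⟪e, y⟫_ℝ)) by linarith, abs_neg, abs_mul]
      gcongr
      rw [abs_of_nonneg (by linarith)]
      linarith
    have h4 : |⟪e, x - y⟫_ℝ| ≤ √((n : ℝ) - k) / c * ‖orthPart e (x - y)‖ := by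
      rw [div_mul_eq_mul_div, le_div_iff₀ hc]
      linarith
    calc ‖x - y‖ = ‖orthPart e (x - y) + ⟪e, x - y⟫_ℝ • e‖ := by rw [orthPart_add_smul]
      _ ≤ ‖orthPart e (x - y)‖ + |⟪e, x - y⟫_ℝ| := by
        refine (norm_add_le _ _).trans_eq ?_
        rw [norm_smul, he, mul_one, Real.norm_eq_abs]
      _ ≤ _ := by linarith
  · gcongr
    refine le_trans (measure_mono ?_) (euclideanHausdorffMeasure_orthogonal_ball_le he hr)
    rintro _ ⟨x, ⟨-, hx⟩, rfl⟩
    exact ⟨inner_orthPart he x, (norm_orthPart_le he x).trans_lt (by simpa using hx)⟩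

/-- At each point one of the last coordinates is at least `c` in absolute value. This covers the
cylinder by finitely many pieces, on each of which the projection along a coordinate axis has a
Lipschitz inverse, so volumes compare with those of flat n-balls. -/
theorem hasPolynomialVolumeGrowth_shrinkingCylinder {k : ℕ} (hk : k < n) :
    HasPolynomialVolumeGrowth (shrinkingCylinder n k) := by
  have hpos : 0 < (n : ℝ) - k := sub_pos.2 (by exact_mod_cast hk)
  -- At most n + 1 coordinates occur in the sum, so n + 2 in the denominator makes their squares
  -- total strictly less than n − k if all are below c².
  set c : ℝ := √(((n : ℝ) - k) / (n + 2)) with hc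
  have hc0 : 0 < c := Real.sqrt_pos.2 (by positivity)
  set J : Finset (Fin (n + 1)) := Finset.univ.filter fun i => k ≤ i.val with hJ
  set B : ℝ≥0∞ := ((1 + √((n : ℝ) - k) / c).toNNReal : ℝ≥0∞) ^ n *
    volume (Metric.ball (0 : EuclideanSpace ℝ (Fin n)) 1) with hB
  have hBfin : J.card * (B + B) ≠ ⊤ := by
    have : volume (Metric.ball (0 : EuclideanSpace ℝ (Fin n)) 1) ≠ ⊤ := measure_ball_lt_top.ne
    finiteness
  refine ⟨(J.card * (B + B)).toNNReal, n, fun r hr => ?_⟩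
  rw [ENNReal.coe_toNNReal hBfin]
  have hr0 : 0 < r := lt_of_lt_of_le one_pos hr
  set S : Ambient n → Set (Ambient n) := fun e =>
    {x ∈ shrinkingCylinder n k | c ≤ ⟪e, x⟫_ℝ} ∩ Metric.ball 0 r with hS
  let b (j : Fin (n + 1)) : Ambient n := EuclideanSpace.single j 1
  have hcover : shrinkingCylinder n k ∩ Metric.ball 0 r ⊆ ⋃ j ∈ J, (S (b j) ∪ S (-b j)) := by
    rintro x ⟨hx, hxr⟩
    obtain ⟨j, hj, hjc⟩ : ∃ j ∈ J, c ^ 2 ≤ x j ^ 2 := by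
      by_contra! hcon
      have h1 := (mem_shrinkingCylinder_iff hk x).1 hx
      rw [inner_tailProj] at h1
      have h2 : ∑ i ∈ J, x i * x i ≤ ∑ i ∈ J, c ^ 2 :=
        Finset.sum_le_sum fun i hi => by rw [← sq]; exact (hcon i hi).le
      rw [h1, Finset.sum_const, nsmul_eq_mul, hc, Real.sq_sqrt (by positivity)] at h2
      have h3 : (J.card : ℝ) ≤ n + 1 := by
        have := Finset.card_le_univ J
        rw [Fintype.card_fin] at this
        exact_mod_cast this
      rw [← mul_div_assoc, le_div_iff₀ (by positivity)] at h2
      nlinarith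
    have hbx : ⟪b j, x⟫_ℝ = x j := by
      simp [b, EuclideanSpace.inner_single_left]
    refine mem_iUnion₂.2 ⟨j, hj, ?_⟩
    rw [sq_le_sq, abs_of_pos hc0] at hjc
    rcases le_abs.1 hjc with h | h
    · exact Or.inl ⟨⟨hx, by rwa [hbx]⟩, hxr⟩
    · exact Or.inr ⟨⟨hx, by rwa [inner_neg_left, hbx]⟩, hxr⟩
  have hb {j} (hj : j ∈ J) : tailProj n k (b j) = b j := by
    ext i
    rw [tailProj_apply]
    split_ifs with h
    · rfl
    · have : i ≠ j := by rintro rfl; exact h (by simpa [hJ] using hj)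
      simp [b, this]
  calc _ ≤ Measure.euclideanHausdorffMeasure n (⋃ j ∈ J, (S (b j) ∪ S (-b j))) :=
        measure_mono hcover
    _ ≤ ∑ j ∈ J, Measure.euclideanHausdorffMeasure n (S (b j) ∪ S (-b j)) :=
        measure_biUnion_finset_le _ _
    _ ≤ ∑ j ∈ J, (B + B) * (r : ℝ≥0∞) ^ n := by
        refine Finset.sum_le_sum fun j hj => (measure_union_le _ _).trans ?_
        rw [add_mul, hB, mul_assoc]
        refine add_le_add ?_ ?_
        · exact euclideanHausdorffMeasure_cylinder_piece_le hk (by simp [b]) (hb hj) hc0 hr0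
        · exact euclideanHausdorffMeasure_cylinder_piece_le hk (by simp [b])
            (by rw [map_neg, hb hj]) hc0 hr0
    _ = _ := by rw [Finset.sum_const, nsmul_eq_mul, mul_assoc]

end Cylinder

theorem mainTheorem7 (n : ℕ) :
    (∀ M : Set (Ambient n), M.Nonempty → IsSmoothHypersurface M → IsIntrinsicallyComplete M →
      HasPolynomialVolumeGrowth M → IsSelfShrinker M →
      (∀ U ν, IsUnitNormalField M U ν → ∀ p ∈ M ∩ U, normSqSecondFundamentalForm M ν p < 1) →
      IsHyperplane M) ∧
    (∀ k : ℕ, k < n →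
      (shrinkingCylinder n k).Nonempty ∧
      IsSmoothHypersurface (shrinkingCylinder n k) ∧
      IsIntrinsicallyComplete (shrinkingCylinder n k) ∧
      HasPolynomialVolumeGrowth (shrinkingCylinder n k) ∧
      IsSelfShrinker (shrinkingCylinder n k) ∧
      (∀ U ν, IsUnitNormalField (shrinkingCylinder n k) U ν → ∀ p ∈ shrinkingCylinder n k ∩ U,
        normSqSecondFundamentalForm (shrinkingCylinder n k) ν p = 1) ∧
      ¬ IsHyperplane (shrinkingCylinder n k)) := by
  refine ⟨fun M hne hM hC hV hS hA => hS.isHyperplane hM hne hC hV hA, fun k hk => ?_⟩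
  have hM := isSmoothHypersurface_shrinkingCylinder hk
  exact ⟨nonempty_shrinkingCylinder hk, hM,
    hM.isIntrinsicallyComplete (isClosed_shrinkingCylinder hk),
    hasPolynomialVolumeGrowth_shrinkingCylinder hk, isSelfShrinker_shrinkingCylinder hk,
    fun _ _ hν _ hp => normSqSecondFundamentalForm_shrinkingCylinder hk hν hp,
    not_isHyperplane_shrinkingCylinder hk⟩
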